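/- Let $\alpha,\beta>0$, let $w\in\mathbb R\setminus\{0\}$, let $N\ge 0$, $a_0,\dots,a_{N-1}\in\mathbb C$, $b_0,\dots,b_{N-1}\in\mathbb R$, and let $$g(t)=\frac{P(t)}{t-iw},\qquad P(t)=\sum_{k=0}^{N-1}a_ke^{2\pi i b_kt}.$$ For $m,n\in\mathbb Z$ put $g_{m,n}(t)=e^{2\pi i\beta m t}g(t-\alpha n)$ and, for $f\in L^2(\mathbb R)$, let $Sf=\sum_{m,n\in\mathbb Z}(f,g_{m,n})\,g_{m,n}$ be the frame operator, where $(f,g)=\int_{\mathbb R} f\,\overline g$. Let $h$ be the tempered distribution $$h(s)=\frac{1}{s-2iw}\sum_{m\in\mathbb Z}e^{2\pi i m\beta s},$$ and put $$h_1^{(1)}(s)=h(s)\sum_{k}\sum_{l:\,b_k>b_l}\overline{a_k}a_l\,e^{2\pi i b_ls}e^{-2\pi w(b_k-b_l)},\qquad h_2^{(1)}(s)=h(s)\sum_{k}\sum_{l:\,b_k>b_l}\overline{a_k}a_l\,e^{2\pi i b_ks}e^{2\pi w(b_k-b_l)},$$ $$h_1^{(2)}(s)=h(s)\sum_{k}\sum_{l:\,b_k<b_l}\overline{a_k}a_l\,e^{2\pi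 i b_ls}e^{-2\pi w(b_k-b_l)},\qquad h_2^{(2)}(s)=h(s)\sum_{k}\sum_{l:\,b_k<b_l}\overline{a_k}a_l\,e^{2\pi i b_ks}e^{2\pi w(b_k-b_l)}.$$ Assume $\alpha\cdot\max_{k,l}|b_k-b_l|\le 1$. Then: 1. The series defining $h$ converges unconditionally in the space of tempered distributions (with the topology of pointwise convergence), and for each $T\in\{h,h_1^{(1)},h_2^{(1)},h_1^{(2)},h_2^{(2)}\}$ the map $\varphi\mapsto\varphi*T$, $(\varphi*T)(x)=T(\varphi(x-\cdot))$, extends from Schwartz functions to a (unique) bounded operator $F\mapsto F*T$ on $L^2(\mathbb R)$. 2. For every $f\in L^2(\mathbb R)$ the series $Sf$ converges unconditionally in $L^2(\mathbb R)$, and for almost every $x\in\mathbb R$ $$\frac{\alpha}{2\pi i}Sf(x)=\left(\frac{f(t)}{e^{2\pi i\frac{t+iw}{\alpha}}-1}*h_1^{(1)}\right)(x)-\frac{1}{e^{2\pi i\frac{x-iw}{\alpha}}-1}\left(f*h_2^{(1)}\right)(x)$$ $$+\left(\frac{f(t)}{1-e^{-2\pi i\frac{t+iw}{\alpha}}}*h_1^{(2)}\right)(x)-\frac{1}{1-e^{-2\pi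 i\frac{x-iw}{\alpha}}}\left(f*h_2^{(2)}\right)(x)$$ $$+\sum_{k=0}^{N-1}\ \sum_{l:\,b_l=b_k}\overline{a_k}a_l\,e^{2\pi i b_kx}\left(\left(\frac{f(t)e^{-2\pi i b_kt}}{e^{2\pi i\frac{t+iw}{\alpha}}-1}*h\right)(x)-\frac{1}{e^{2\pi i\frac{x-iw}{\alpha}}-1}\left(f(t)e^{-2\pi i b_kt}*h\right)(x)\right).$$ (If the $b_k$ are pairwise distinct, the last double sum is $\sum_k|a_k|^2e^{2\pi i b_kx}(\cdots)$.) -/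

import Mathlib

open MeasureTheory Complex SchwartzMap
open scoped Real ENNReal

noncomputable section

/-! ### Functions as elements of `L²(ℝ)` -/

/-- The class in `L²(ℝ)` of a square-integrable function (and `0` if it is not square-integrable). -/
def toL2 (F : ℝ → ℂ) : Lp ℂ 2 (volume : Measure ℝ) :=
  open Classical in if h : MemLp F 2 volume then h.toLp F else 0

theorem toL2_ae {F : ℝ → ℂ} (h : MemLp F 2 volume) : toL2 F =ᵐ[volume] F := by
  rw [toL2, dif_pos h]
  exact h.coeFn_toLp

/-- The product of an `L²` function by a bounded continuous function is in `L²`. -/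
theorem memLp_mul_of_bounded {u F : ℝ → ℂ} (hu : Continuous u) (C : ℝ) (hC : ∀ x, ‖u x‖ ≤ C)
    (hF : MemLp F 2 volume) : MemLp (fun x => F x * u x) 2 volume := by
  refine MemLp.of_le_mul (c := C) hF (hF.1.mul hu.aestronglyMeasurable) (.of_forall fun x => ?_)
  rw [norm_mul, mul_comm]
  exact mul_le_mul_of_nonneg_right (hC x) (norm_nonneg _)

/-! ### Gabor systems and the frame operator -/

/-- The time-frequency shift `π_{x,ω} g (t) = e^{2πiωt} g(t - x)`. -/
def tfShift (x ω : ℝ) (g : ℝ → ℂ) (t : ℝ) : ℂ :=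
  cexp (2 * π * I * ω * t) * g (t - x)

/-- The element `π_{αn, βm} g` of the Gabor system, indexed by the pair `(m, n)`. -/
def gaborAtom (g : ℝ → ℂ) (α β : ℝ) (p : ℤ × ℤ) : Lp ℂ 2 (volume : Measure ℝ) :=
  toL2 (tfShift (α * p.2) (β * p.1) g)

/-- The terms `(f, g_{m,n}) g_{m,n}` of the frame operator; `inner ℂ g f = ∫ conj g * f`. -/
def frameTerm (g : ℝ → ℂ) (α β : ℝ) (f : Lp ℂ 2 (volume : Measure ℝ)) (p : ℤ × ℤ) :
    Lp ℂ 2 (volume : Measure ℝ) :=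
  (inner ℂ (gaborAtom g α β p) f) • gaborAtom g α β p

/-- The frame operator `S f = ∑_{m,n} (f, g_{m,n}) g_{m,n}`, the series converging in `L²(ℝ)`. -/
def frameOperator (g : ℝ → ℂ) (α β : ℝ) (f : Lp ℂ 2 (volume : Measure ℝ)) :
    Lp ℂ 2 (volume : Measure ℝ) :=
  ∑' p : ℤ × ℤ, frameTerm g α β f p

/-- The window `P(t) / (t - iw)`, `P(t) = ∑ₖ aₖ e^{2πi bₖ t}`. -/
def trigCauchyWindow {N : ℕ} (a : Fin N → ℂ) (b : Fin N → ℝ) (w : ℝ) (t : ℝ) : ℂ :=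
  (∑ k, a k * cexp (2 * π * I * b k * t)) / (t - I * w)

theorem norm_char (c t : ℝ) : ‖cexp (2 * π * I * c * t)‖ = 1 := by
  rw [show (2 * π * I * c * t : ℂ) = ((2 * π * c * t : ℝ) : ℂ) * I by push_cast; ring]
  exact norm_exp_ofReal_mul_I _

theorem sub_mul_I_ne_zero {w : ℝ} (hw : w ≠ 0) (t : ℝ) : (t - I * w : ℂ) ≠ 0 := by
  intro h
  have := congrArg Complex.im h
  simp at this
  exact hw this

theorem memLp_trigCauchyWindow {N : ℕ} (a : Fin N → ℂ) (b : Fin N → ℝ) {w : ℝ} (hw : w ≠ 0) :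
    MemLp (trigCauchyWindow a b w) 2 volume := by
  have hc : Continuous fun t : ℝ => (t - I * w : ℂ)⁻¹ :=
    (by fun_prop : Continuous fun t : ℝ => (t - I * w : ℂ)).inv₀ (sub_mul_I_ne_zero hw)
  have h1 : MemLp (fun t : ℝ => (t - I * w : ℂ)⁻¹) 2 volume := by
    rw [memLp_two_iff_integrable_sq_norm hc.aestronglyMeasurable]
    have hi : Integrable (fun t : ℝ => (w ^ 2)⁻¹ * (1 + (t * w⁻¹) ^ 2)⁻¹) :=
      ((integrable_inv_one_add_sq.comp_mul_right' (inv_ne_zero hw))).const_mul _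
    refine hi.congr (.of_forall fun t => ?_)
    have hn : ‖(t - I * w : ℂ)‖ ^ 2 = t ^ 2 + w ^ 2 := by
      rw [← normSq_eq_norm_sq, normSq_apply]; simp; ring
    simp only [norm_inv, inv_pow, hn]
    rw [← mul_inv]
    congr 1
    field_simp
    ring
  have h2 := memLp_mul_of_bounded (u := fun t => ∑ k, a k * cexp (2 * π * I * b k * t))
    (by fun_prop) (∑ k, ‖a k‖) (fun x => (norm_sum_le _ _).trans
      (Finset.sum_le_sum fun k _ => by rw [norm_mul, norm_char, mul_one])) h1
  refine h2.congr_norm ?_ (.of_forall fun t => ?_)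
  · exact (((by fun_prop : Continuous fun t : ℝ => ∑ k, a k * cexp (2 * π * I * b k * t)).mul
      hc).congr fun t => by
        simp only [trigCauchyWindow, div_eq_mul_inv, Pi.mul_apply]).aestronglyMeasurable
  · rw [trigCauchyWindow, div_eq_mul_inv, mul_comm]

theorem memLp_tfShift {g : ℝ → ℂ} (hg : MemLp g 2 volume) (x ω : ℝ) :
    MemLp (tfShift x ω g) 2 volume := by
  have h1 : MemLp (fun t => g (t - x)) 2 volume :=
    hg.comp_measurePreserving (measurePreserving_sub_right volume x)
  have := memLp_mul_of_bounded (u := fun t : ℝ => cexp (2 * π * I * ω * t)) (by fun_prop) 1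
    (fun t => (norm_char ω t).le) h1
  have he : tfShift x ω g = fun t => g (t - x) * cexp (2 * π * I * ω * t) := by
    funext t
    rw [tfShift, mul_comm]
  rwa [he]

/-! ### Convolution of a tempered distribution with an `L²` function -/

/-- The Schwartz function `t ↦ φ (x - t)`. -/
def reflectAt (φ : 𝓢(ℝ, ℂ)) (x : ℝ) : 𝓢(ℝ, ℂ) :=
  compCLMOfAntilipschitz ℂ (g := fun t : ℝ => x - t) (K := 1) (by fun_prop)
    (AntilipschitzWith.of_le_mul_dist fun s t => by
      simp only [NNReal.coe_one, one_mul, Real.dist_eq, sub_sub_sub_cancel_left]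
      exact (abs_sub_comm s t).le) φ

theorem reflectAt_apply (φ : 𝓢(ℝ, ℂ)) (x t : ℝ) : reflectAt φ x t = φ (x - t) := rfl

/-- The convolution of a tempered distribution `T` with a Schwartz function,
`(φ * T)(x) = T (t ↦ φ (x - t))`. -/
def schwartzConv (T : 𝓢'(ℝ, ℂ)) (φ : 𝓢(ℝ, ℂ)) (x : ℝ) : ℂ := T (reflectAt φ x)

/-- The bounded operator `C` on `L²(ℝ)` is convolution with `T`: it is the continuous extension
of `φ ↦ φ * T` from Schwartz functions to `L²(ℝ)`. -/
def IsConvolutionBy (T : 𝓢'(ℝ, ℂ))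
    (C : Lp ℂ 2 (volume : Measure ℝ) →L[ℂ] Lp ℂ 2 (volume : Measure ℝ)) : Prop :=
  ∀ φ : 𝓢(ℝ, ℂ), C (φ.toLp 2 volume) =ᵐ[volume] schwartzConv T φ

/-- `φ ↦ φ * T` extends to a bounded operator on `L²(ℝ)`. -/
def IsL2Convolutor (T : 𝓢'(ℝ, ℂ)) : Prop := ∃ C, IsConvolutionBy T C

/-- The extension is unique. -/
theorem IsConvolutionBy.unique {T : 𝓢'(ℝ, ℂ)}
    {C D : Lp ℂ 2 (volume : Measure ℝ) →L[ℂ] Lp ℂ 2 (volume : Measure ℝ)}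
    (hC : IsConvolutionBy T C) (hD : IsConvolutionBy T D) : C = D := by
  have hd := SchwartzMap.denseRange_toLpCLM (E := ℝ) (F := ℂ) (p := 2) (μ := volume) (by simp)
  refine DFunLike.coe_injective (hd.equalizer C.continuous D.continuous ?_)
  funext φ
  exact Lp.ext ((hC φ).trans (hD φ).symm)

/-- The convolution `F * T` of `F ∈ L²(ℝ)` with an `L²`-convolutor `T`. -/
def convL2 (T : 𝓢'(ℝ, ℂ)) (F : Lp ℂ 2 (volume : Measure ℝ)) : Lp ℂ 2 (volume : Measure ℝ) :=
  open Classical in if h : IsL2Convolutor T then h.choose F else 0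

theorem IsConvolutionBy.convL2_eq {T : 𝓢'(ℝ, ℂ)}
    {C : Lp ℂ 2 (volume : Measure ℝ) →L[ℂ] Lp ℂ 2 (volume : Measure ℝ)}
    (hC : IsConvolutionBy T C) (F : Lp ℂ 2 (volume : Measure ℝ)) : convL2 T F = C F := by
  have h : IsL2Convolutor T := ⟨C, hC⟩
  rw [convL2, dif_pos h, h.choose_spec.unique hC]

/-! ### The distribution `h` and the kernels built from it -/

theorem hasTemperateGrowth_char (c : ℝ) :
    (fun s : ℝ => cexp (2 * π * I * c * s)).HasTemperateGrowth := by
  have hk : ∀ n, iteratedDeriv n (fun s : ℝ => cexp (2 * π * I * c * s)) =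
      fun s : ℝ => (2 * π * I * c) ^ n * cexp (2 * π * I * c * s) := by
    intro n
    induction n with
    | zero => simp
    | succ n ih =>
      rw [iteratedDeriv_succ, ih]
      funext s
      have h1 : HasDerivAt (fun s : ℝ => 2 * π * I * c * (s : ℂ)) (2 * π * I * c) s := by
        simpa using (Complex.ofRealCLM.hasDerivAt (x := s)).const_mul (2 * π * I * c : ℂ)
      rw [(h1.cexp.const_mul _).deriv]
      ring
  refine ⟨((contDiff_const.mul Complex.ofRealCLM.contDiff).cexp : _), fun n => ⟨0, (2 * π * |c|) ^ n, fun s => ?_⟩⟩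
  rw [norm_iteratedFDeriv_eq_norm_iteratedDeriv, hk, norm_mul, norm_char, norm_pow]
  simp [abs_of_pos Real.pi_pos]

/-- The function `s ↦ e^{2πics}` as a tempered distribution. -/
def charDist (c : ℝ) : 𝓢'(ℝ, ℂ) :=
  (hasTemperateGrowth_char c).toTemperedDistribution volume

theorem hasTemperateGrowth_inv_sub {w : ℝ} (hw : w ≠ 0) :
    (fun s : ℝ => 1 / (s - 2 * I * w : ℂ)).HasTemperateGrowth := by
  have h1 : (fun s : ℝ => (1 + ‖s‖ ^ 2) ^ (-1 : ℝ)).HasTemperateGrowth := by fun_prop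
  have h2 : (fun s : ℝ => (2 * w)⁻¹ * s).HasTemperateGrowth := by fun_prop
  have h3 := Function.HasTemperateGrowth.comp (g := Complex.ofReal)
    Function.Complex.hasTemperateGrowth_ofReal (h1.comp h2)
  have h4 : (fun s : ℝ => ((((2 * w) ^ 2)⁻¹ : ℝ) : ℂ) * ((s : ℂ) + 2 * I * w)).HasTemperateGrowth :=
    (Function.HasTemperateGrowth.const _).mul
      (Function.HasTemperateGrowth.add (f := Complex.ofReal)
      Function.Complex.hasTemperateGrowth_ofReal (Function.HasTemperateGrowth.const _))
  refine Eq.mp (congrArg Function.HasTemperateGrowth ?_) (h4.mul h3)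
  funext s
  have hne : (s - 2 * I * w : ℂ) ≠ 0 := by
    intro h
    have := congrArg Complex.im h
    simp at this
    exact hw this
  have hne' : (s + 2 * I * w : ℂ) ≠ 0 := by
    intro h
    have := congrArg Complex.im h
    simp at this
    exact hw this
  have hw' : (w : ℂ) ≠ 0 := by exact_mod_cast hw
  simp only [Pi.mul_apply, Function.comp_apply, Real.rpow_neg_one, Real.norm_eq_abs, sq_abs]
  have e : ((1 + ((2 * w)⁻¹ * s) ^ 2 : ℝ) : ℂ) =
      (s - 2 * I * w) * (s + 2 * I * w) * ((2 * w : ℂ) ^ 2)⁻¹ := by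
    push_cast
    field_simp
    ring_nf
    rw [I_sq]
    ring
  push_cast at e ⊢
  have hne2 : (s + 2 * w * I : ℂ) ≠ 0 := by
    convert hne' using 2
    ring
  rw [e, mul_inv, mul_inv, inv_inv, one_div]
  field_simp

/-- The distribution `h(s) = (s - 2iw)⁻¹ ∑_{m ∈ ℤ} e^{2πimβs}`: the series converges in the space of
tempered distributions and the sum is multiplied by the smooth function `(s - 2iw)⁻¹`. -/
def hDist (β w : ℝ) : 𝓢'(ℝ, ℂ) :=
  TemperedDistribution.smulLeftCLM ℂ (fun s : ℝ => 1 / (s - 2 * I * w : ℂ))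
    (∑' m : ℤ, charDist (m * β))

variable {N : ℕ} (a : Fin N → ℂ) (b : Fin N → ℝ) (w : ℝ)

/-- The trigonometric polynomial `∑_{bₖ > bₗ} āₖ aₗ e^{2πi bₗ s} e^{-2πw(bₖ - bₗ)}`. -/
def trigGtFst (s : ℝ) : ℂ :=
  ∑ k, ∑ l with b l < b k, star (a k) * a l * cexp (2 * π * I * b l * s) *
    cexp (-(2 * π * w * (b k - b l)))

/-- The trigonometric polynomial `∑_{bₖ > bₗ} āₖ aₗ e^{2πi bₖ s} e^{2πw(bₖ - bₗ)}`. -/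
def trigGtSnd (s : ℝ) : ℂ :=
  ∑ k, ∑ l with b l < b k, star (a k) * a l * cexp (2 * π * I * b k * s) *
    cexp (2 * π * w * (b k - b l))

/-- The trigonometric polynomial `∑_{bₖ < bₗ} āₖ aₗ e^{2πi bₗ s} e^{-2πw(bₖ - bₗ)}`. -/
def trigLtFst (s : ℝ) : ℂ :=
  ∑ k, ∑ l with b k < b l, star (a k) * a l * cexp (2 * π * I * b l * s) *
    cexp (-(2 * π * w * (b k - b l)))

/-- The trigonometric polynomial `∑_{bₖ < bₗ} āₖ aₗ e^{2πi bₖ s} e^{2πw(bₖ - bₗ)}`. -/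
def trigLtSnd (s : ℝ) : ℂ :=
  ∑ k, ∑ l with b k < b l, star (a k) * a l * cexp (2 * π * I * b k * s) *
    cexp (2 * π * w * (b k - b l))

theorem hasTemperateGrowth_trig (c : Fin N → Fin N → ℂ) (d : Fin N → Fin N → ℂ)
    (e : Fin N → Fin N → ℝ) (r : Fin N → Fin N → Prop) [∀ k l, Decidable (r k l)] :
    (fun s : ℝ => ∑ k, ∑ l with r k l, c k l * cexp (2 * π * I * e k l * s) * d k l
      ).HasTemperateGrowth :=
  Function.HasTemperateGrowth.sum fun _ _ => Function.HasTemperateGrowth.sum fun _ _ =>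
    (((Function.HasTemperateGrowth.const _).mul (hasTemperateGrowth_char _)).mul
      (Function.HasTemperateGrowth.const _))

theorem hasTemperateGrowth_trigGtFst : (trigGtFst a b w).HasTemperateGrowth :=
  hasTemperateGrowth_trig (fun k l => star (a k) * a l) _ (fun _ l => b l) (fun k l => b l < b k)

theorem hasTemperateGrowth_trigGtSnd : (trigGtSnd a b w).HasTemperateGrowth :=
  hasTemperateGrowth_trig (fun k l => star (a k) * a l) _ (fun k _ => b k) (fun k l => b l < b k)

theorem hasTemperateGrowth_trigLtFst : (trigLtFst a b w).HasTemperateGrowth :=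
  hasTemperateGrowth_trig (fun k l => star (a k) * a l) _ (fun _ l => b l) (fun k l => b k < b l)

theorem hasTemperateGrowth_trigLtSnd : (trigLtSnd a b w).HasTemperateGrowth :=
  hasTemperateGrowth_trig (fun k l => star (a k) * a l) _ (fun k _ => b k) (fun k l => b k < b l)

variable (β : ℝ)

/-- The kernel `h₁⁽¹⁾`. -/
def h1Sup1 : 𝓢'(ℝ, ℂ) := TemperedDistribution.smulLeftCLM ℂ (trigGtFst a b w) (hDist β w)

/-- The kernel `h₂⁽¹⁾`. -/
def h2Sup1 : 𝓢'(ℝ, ℂ) := TemperedDistribution.smulLeftCLM ℂ (trigGtSnd a b w) (hDist β w)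

/-- The kernel `h₁⁽²⁾`. -/
def h1Sup2 : 𝓢'(ℝ, ℂ) := TemperedDistribution.smulLeftCLM ℂ (trigLtFst a b w) (hDist β w)

/-- The kernel `h₂⁽²⁾`. -/
def h2Sup2 : 𝓢'(ℝ, ℂ) := TemperedDistribution.smulLeftCLM ℂ (trigLtSnd a b w) (hDist β w)

/-! ### The multipliers in the formula preserve `L²(ℝ)` -/

theorem norm_exp_shift (α c t : ℝ) :
    ‖cexp (2 * π * I * ((t + I * c) / α))‖ = Real.exp (-(2 * π * c / α)) := by
  rw [Complex.norm_exp,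
    show (2 * π * I * ((t + I * c) / α) : ℂ) = ((2 * π * t / α : ℝ) : ℂ) * I +
      ((-(2 * π * c / α) : ℝ) : ℂ) by
        push_cast; linear_combination (2 * π * c / α : ℂ) * I_sq]
  rw [Complex.add_re, Complex.re_ofReal_mul, Complex.ofReal_re]
  simp

theorem memLp_mul_inv_sub {e : ℝ → ℂ} (he : Continuous e) {r : ℝ} (hr : r ≠ 1)
    (hn : ∀ t, ‖e t‖ = r) {F : ℝ → ℂ} (hF : MemLp F 2 volume) :
    MemLp (fun t => F t * (e t - 1)⁻¹) 2 volume := by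
  have hb : ∀ t, |r - 1| ≤ ‖e t - 1‖ := fun t => by
    simpa [hn t] using abs_norm_sub_norm_le (e t) 1
  have hpos : 0 < |r - 1| := abs_pos.2 (sub_ne_zero.2 hr)
  refine memLp_mul_of_bounded ((he.sub continuous_const).inv₀ fun t =>
    norm_pos_iff.1 (hpos.trans_le (hb t))) |r - 1|⁻¹ (fun t => ?_) hF
  rw [norm_inv]
  exact inv_anti₀ hpos (hb t)

theorem memLp_div_exp_sub_one {α c : ℝ} (hα : α ≠ 0) (hc : c ≠ 0) {F : ℝ → ℂ}
    (hF : MemLp F 2 volume) :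
    MemLp (fun t : ℝ => F t / (cexp (2 * π * I * ((t + I * c) / α)) - 1)) 2 volume := by
  simp only [div_eq_mul_inv (F _)]
  refine memLp_mul_inv_sub (by fun_prop) ?_ (norm_exp_shift α c) hF
  simp [hα, hc, Real.pi_ne_zero]

theorem memLp_div_one_sub_exp {α c : ℝ} (hα : α ≠ 0) (hc : c ≠ 0) {F : ℝ → ℂ}
    (hF : MemLp F 2 volume) :
    MemLp (fun t : ℝ => F t / (1 - cexp (-(2 * π * I * ((t + I * c) / α))))) 2 volume := by
  have h := (memLp_mul_inv_sub (e := fun t : ℝ => cexp (-(2 * π * I * ((t + I * c) / α))))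
    (by fun_prop) (r := Real.exp (2 * π * c / α)) (by simp [hα, hc, Real.pi_ne_zero])
    (fun t => by rw [Complex.exp_neg, norm_inv, norm_exp_shift, ← Real.exp_neg, neg_neg]) hF).neg
  refine h.congr_norm (h.1.congr (.of_forall fun t => ?_)) (.of_forall fun t => ?_) <;>
  · simp only [Pi.neg_apply]
    rw [← neg_sub (cexp _) 1, div_neg, div_eq_mul_inv (F t) (cexp _ - 1)]

theorem memLp_mul_char {F : ℝ → ℂ} (hF : MemLp F 2 volume) (c : ℝ) :
    MemLp (fun t : ℝ => F t * cexp (-(2 * π * I * c * t))) 2 volume := by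
  refine memLp_mul_of_bounded (by fun_prop) 1 (fun t => ?_) hF
  rw [Complex.exp_neg, norm_inv, norm_char, inv_one]

end

/-! The formula is Walnut's representation with its kernel summed in closed form. On test functions,
Poisson summation over the modulations `m` gives `Sf(x) = β⁻¹ ∑ⱼ f(x - j/β) G(x, j/β)`, where `G(x,
s) = ∑ₙ g(x - αn) conj(g(x - s - αn))`. Expanding `P`, the pair `(k, l)` contributes a product of
two Cauchy kernels times `e^{2πinα(bₖ - bₗ)}`. Partial fractions turn the product into `(s - 2iw)⁻¹`
times a difference of two simple poles, and the sum over `n` becomes an absolutely convergent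
Fourier series of an explicit continuous function on the circle
(`hasSum_char_mul_inv_sub_sub_inv_sub`), evaluated at `α(bₖ - bₗ)` modulo 1. Since `α|bₖ - bₗ| ≤ 1`,
a representative in `[0, 1]` is `α(bₖ - bₗ)` or `α(bₖ - bₗ) + 1` according to the sign of `bₖ - bₗ`;
this produces the two families of kernels. For `bₖ ≠ bₗ` each value splits into a function of `s`
times a function of `x - s` or of `x`, that is, into a convolution with a multiplier applied before
or after it.

By Poisson summation `h` is the Dirac comb on `β⁻¹ℤ` with weights `β⁻¹(j/β - 2iw)⁻¹`. On each coset
of `β⁻¹ℤ`, convolution with `h` is a discrete convolution. Its sequence is not summable, but it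
consists of Fourier coefficients of a bounded function, so Parseval bounds it on `ℓ²`
(`exists_tsum_enorm_sq_conv_le`).

No Bessel property of the Gabor system is presupposed. The right-hand side is a bounded operator
agreeing weakly with the iterated sums over `m`, then `n`, on test functions. On the diagonal these
sums have nonnegative terms, so the identity itself yields the Bessel bound, hence unconditional
convergence, and density with symmetry extends the identity to all of `L²` (`bessel_of_weak`,
`hasSum_frame_of_weak`). -/

/-! ### Quadratic decay of translated Cauchy kernels -/

theorem summable_inv_one_add_int_sq : Summable fun n : ℤ => (1 + (n : ℝ) ^ 2)⁻¹ := by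
  -- Comparison with `2 / (n + 1/2)²`: the shift by `1/2` avoids a vanishing denominator at `n = 0`.
  refine Summable.of_nonneg_of_le (fun n => by positivity) (fun n => ?_)
    (((Real.summable_one_div_int_add_rpow (1 / 2) 2).2 (by norm_num)).mul_left 2)
  have h0 : (n : ℝ) + 1 / 2 ≠ 0 := by
    intro h
    have : (2 * n + 1 : ℝ) = 0 := by linarith
    have : (2 * n + 1 : ℤ) = 0 := by exact_mod_cast this
    omega
  have h1 : 0 < ((n : ℝ) + 1 / 2) ^ 2 := by positivity
  rw [Real.rpow_two, sq_abs, inv_eq_one_div, mul_one_div, div_le_div_iff₀ (by positivity) h1]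
  nlinarith [sq_nonneg ((n : ℝ) - 1 / 2)]

theorem exists_inv_sq_add_sq_le {α w : ℝ} (hα : α ≠ 0) (hw : w ≠ 0) (R : ℝ) :
    ∃ K, 0 ≤ K ∧ ∀ x : ℝ, |x| ≤ R → ∀ n : ℤ,
      ((x - α * n) ^ 2 + w ^ 2)⁻¹ ≤ K * (1 + (n : ℝ) ^ 2)⁻¹ := by
  have hα' : 0 < α ^ 2 := by positivity
  have hw' : 0 < w ^ 2 := by positivity
  -- The constant comes from `(αn)² ≤ 2(x - αn)² + 2x²`; the second term absorbs `1 + 2R²/α²` into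
  -- the summand `w²`.
  refine ⟨2 / α ^ 2 + (2 * R ^ 2 / α ^ 2 + 1) / w ^ 2, by positivity, fun x hx n => ?_⟩
  have hx2 : x ^ 2 ≤ R ^ 2 := sq_le_sq' (by linarith [neg_abs_le x]) ((le_abs_self x).trans hx)
  rw [← div_eq_mul_inv, inv_eq_one_div, div_le_div_iff₀ (by positivity) (by positivity), one_mul]
  set A := (x - α * n) ^ 2 with hA
  have hA0 : 0 ≤ A := sq_nonneg _
  have h1 : (n : ℝ) ^ 2 ≤ 2 / α ^ 2 * A + 2 * R ^ 2 / α ^ 2 := by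
    rw [show 2 / α ^ 2 * A + 2 * R ^ 2 / α ^ 2 = (2 * A + 2 * R ^ 2) / α ^ 2 by ring,
      le_div_iff₀ hα']
    nlinarith [sq_nonneg (2 * x - α * n)]
  have h2 : (2 * R ^ 2 / α ^ 2 + 1) / w ^ 2 * w ^ 2 = 2 * R ^ 2 / α ^ 2 + 1 := by field_simp
  have h3 : 0 ≤ (2 * R ^ 2 / α ^ 2 + 1) / w ^ 2 * A := by positivity
  have h4 : 0 ≤ 2 / α ^ 2 * w ^ 2 := by positivity
  nlinarith

/-! ### Fourier series of exponentials on the unit interval -/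

theorem exp_two_pi_mul_I_mul_ne_one {z : ℂ} (hz : z.im ≠ 0) : cexp (2 * π * I * z) ≠ 1 := by
  intro h
  have := congrArg norm h
  rw [Complex.norm_exp, norm_one, Real.exp_eq_one_iff] at this
  simp [Real.pi_ne_zero, hz] at this

/-- The difference equals `(z₂ - z₁) / ((z₁ - n)(z₂ - n))`, which decays quadratically, whereas a
single pole gives only `1/n`. -/
theorem summable_inv_sub_intCast_sub {z₁ z₂ : ℂ} (h₁ : z₁.im ≠ 0) (h₂ : z₂.im ≠ 0) :
    Summable fun n : ℤ => 1 / (z₁ - n) - 1 / (z₂ - n) := by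
  have key : ∀ z : ℂ, z.im ≠ 0 → ∃ K, ∀ n : ℤ, (z - n ≠ 0) ∧
      ‖(z - n)⁻¹‖ ^ 2 ≤ K * (1 + (n : ℝ) ^ 2)⁻¹ := fun z hz => by
    obtain ⟨K, -, hK⟩ := exists_inv_sq_add_sq_le one_ne_zero hz |z.re|
    refine ⟨K, fun n => ⟨fun h => hz (by simpa using congrArg Complex.im h), ?_⟩⟩
    convert hK z.re le_rfl n using 1
    rw [norm_inv, inv_pow, ← normSq_eq_norm_sq, normSq_apply]
    simp; ring
  obtain ⟨K₁, hK₁⟩ := key z₁ h₁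
  obtain ⟨K₂, hK₂⟩ := key z₂ h₂
  refine Summable.of_norm_bounded (summable_inv_one_add_int_sq.mul_left (‖z₂ - z₁‖ * (K₁ + K₂)))
    fun n => ?_
  have e : 1 / (z₁ - n) - 1 / (z₂ - n) = (z₂ - z₁) * ((z₁ - n)⁻¹ * (z₂ - n)⁻¹) := by
    have := (hK₁ n).1
    have := (hK₂ n).1
    field_simp
    ring
  rw [e, norm_mul, mul_assoc, norm_mul]
  refine mul_le_mul_of_nonneg_left ?_ (norm_nonneg _)
  nlinarith [(hK₁ n).2, (hK₂ n).2, sq_nonneg (‖(z₁ - n : ℂ)⁻¹‖ - ‖(z₂ - n : ℂ)⁻¹‖),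
    sq_nonneg ‖(z₁ - n : ℂ)⁻¹‖, sq_nonneg ‖(z₂ - n : ℂ)⁻¹‖]

/-- The Fourier coefficients of an exponential on the unit interval. -/
theorem integral_char_mul_exp {z : ℂ} (hz : z.im ≠ 0) (n : ℤ) :
    ∫ x in (0 : ℝ)..1, cexp (-(2 * π * I * n * x)) * cexp (2 * π * I * x * z) =
      (cexp (2 * π * I * z) - 1) / (2 * π * I * (z - n)) := by
  have hz' : z - n ≠ 0 := fun h => hz (by simpa using congrArg Complex.im h)
  have hc : 2 * π * I * (z - n) ≠ 0 :=
    mul_ne_zero (mul_ne_zero (mul_ne_zero two_ne_zero (by exact_mod_cast Real.pi_ne_zero))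
      I_ne_zero) hz'
  have h := integral_exp_mul_complex (a := 0) (b := 1) hc
  simp only [ofReal_one, ofReal_zero, mul_one, mul_zero, Complex.exp_zero] at h
  rw [show (2 * π * I * (z - n) : ℂ) = 2 * π * I * z - n * (2 * π * I) by ring] at h ⊢
  rw [Complex.exp_sub, Complex.exp_int_mul_two_pi_mul_I, div_one] at h
  rw [← h]
  refine intervalIntegral.integral_congr fun x _ => ?_
  simp only [← Complex.exp_add]
  congr 1
  ring

/-- For every `z` the function `e^{2πiθz} / (e^{2πiz} - 1)` increases by exactly 1 from `θ = 0` to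
`θ = 1`. In the difference for `z₁` and `z₂` these jumps cancel, so it is continuous on the circle;
its Fourier coefficients are summable, and the series therefore converges to it everywhere, both
endpoints included. -/
theorem hasSum_char_mul_inv_sub_sub_inv_sub {z₁ z₂ : ℂ} (h₁ : z₁.im ≠ 0) (h₂ : z₂.im ≠ 0)
    {θ : ℝ} (h0 : 0 ≤ θ) (h1 : θ ≤ 1) :
    HasSum (fun n : ℤ => cexp (2 * π * I * n * θ) * (1 / (z₁ - n) - 1 / (z₂ - n)))
      (2 * π * I * (cexp (2 * π * I * θ * z₁) / (cexp (2 * π * I * z₁) - 1) -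
        cexp (2 * π * I * θ * z₂) / (cexp (2 * π * I * z₂) - 1))) := by
  have e₁ := sub_ne_zero.2 (exp_two_pi_mul_I_mul_ne_one h₁)
  have e₂ := sub_ne_zero.2 (exp_two_pi_mul_I_mul_ne_one h₂)
  set D : ℝ → ℂ := fun θ =>
    (2 * π * I * (cexp (2 * π * I * θ * z₁) / (cexp (2 * π * I * z₁) - 1) -
        cexp (2 * π * I * θ * z₂) / (cexp (2 * π * I * z₂) - 1))) with hD
  have hDc : Continuous D := by fun_prop
  have hper : D 0 = D (0 + 1) := by
    simp only [hD]
    push_cast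
    simp only [mul_zero, zero_mul, Complex.exp_zero, zero_add, mul_one]
    congr 1
    field_simp
    ring
  have : Fact ((0 : ℝ) < 1) := ⟨one_pos⟩
  let F : C(AddCircle (1 : ℝ), ℂ) := ⟨AddCircle.liftIco 1 0 D,
    AddCircle.liftIco_continuous hper hDc.continuousOn⟩
  have hFD : ∀ x : ℝ, 0 ≤ x → x < 1 → F (x : AddCircle (1 : ℝ)) = D x := fun x hx hx' =>
    AddCircle.liftIco_coe_apply (p := (1 : ℝ)) (a := 0) (f := D) ⟨hx, by simpa using hx'⟩
  have hfour : ∀ (n : ℤ) (x : ℝ), fourier n (x : AddCircle (1 : ℝ)) = cexp (2 * π * I * n * x) :=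
    fun n x => by
      rw [fourier_coe_apply]
      simp
  have hcoef : ∀ n : ℤ, fourierCoeff F n = 1 / (z₁ - n) - 1 / (z₂ - n) := by
    intro n
    have g₁ : z₁ - n ≠ 0 := fun h => h₁ (by simpa using congrArg Complex.im h)
    have g₂ : z₂ - n ≠ 0 := fun h => h₂ (by simpa using congrArg Complex.im h)
    have hpi : (π : ℂ) ≠ 0 := by exact_mod_cast Real.pi_ne_zero
    have hint : (∫ x in (0 : ℝ)..1, fourier (-n) (x : AddCircle (1 : ℝ)) • F x) =
      ∫ x in (0 : ℝ)..1, ((2 * π * I / (cexp (2 * π * I * z₁) - 1)) *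
          (cexp (-(2 * π * I * n * x)) * cexp (2 * π * I * x * z₁)) -
        (2 * π * I / (cexp (2 * π * I * z₂) - 1)) *
          (cexp (-(2 * π * I * n * x)) * cexp (2 * π * I * x * z₂))) := by
      refine intervalIntegral.integral_congr_Ioo_of_le zero_le_one fun x hx => ?_
      rw [hfour, hFD x hx.1.le hx.2, smul_eq_mul]
      simp only [hD]
      push_cast
      rw [show (2 * π * I * -n * x : ℂ) = -(2 * π * I * n * x) by ring]
      ring
    rw [fourierCoeff_eq_intervalIntegral _ n 0, zero_add, hint, intervalIntegral.integral_sub,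
      intervalIntegral.integral_const_mul, intervalIntegral.integral_const_mul,
      integral_char_mul_exp h₁, integral_char_mul_exp h₂, div_one, one_smul]
    · field_simp
    all_goals exact (Continuous.intervalIntegrable (by fun_prop) _ _)
  have hs : Summable (fourierCoeff F) :=
    (summable_inv_sub_intCast_sub h₁ h₂).congr fun n => (hcoef n).symm
  have hsum := has_pointwise_sum_fourier_series_of_summable hs (θ : AddCircle (1 : ℝ))
  have hv : F (θ : AddCircle (1 : ℝ)) = D θ := by
    rcases h1.lt_or_eq with h | h
    · exact hFD θ h0 h
    · have : ((1 : ℝ) : AddCircle (1 : ℝ)) = ((0 : ℝ) : AddCircle (1 : ℝ)) := by simp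
      rw [h, this, hFD 0 le_rfl one_pos, hper, zero_add]
  simp only [hv, hcoef, hfour, smul_eq_mul, mul_comm (_ - _) (cexp _)] at hsum
  exact hsum

/-! ### Discrete convolutions on `ℓ²` through Parseval -/

theorem fourierCoeffOn_zero_one (f : ℝ → ℂ) (n : ℤ) :
    fourierCoeffOn zero_lt_one f n = ∫ x in (0 : ℝ)..1, cexp (-(2 * π * I * n * x)) * f x := by
  rw [fourierCoeffOn_eq_integral, sub_zero, div_one, one_smul]
  refine intervalIntegral.integral_congr fun x _ => ?_
  simp only [fourier_coe_apply, smul_eq_mul]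
  congr 2
  push_cast
  rw [div_one]
  ring

theorem norm_char_int (n : ℤ) (x : ℝ) : ‖cexp (2 * π * I * n * x)‖ = 1 := by
  simpa using norm_char n x

theorem norm_char_neg (c x : ℝ) : ‖cexp (-(2 * π * I * c * x))‖ = 1 := by
  rw [Complex.exp_neg, norm_inv, norm_char, inv_one]

/-- The Fourier coefficients of a product with an absolutely convergent Fourier series. -/
theorem fourierCoeffOn_mul_tsum {u : ℝ → ℂ} (hu : Continuous u) {a : ℤ → ℂ} (ha : Summable a)
    (k : ℤ) :
    fourierCoeffOn zero_lt_one (fun x => u x * ∑' j, a j * cexp (2 * π * I * j * x)) k =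
      ∑' j, a (k - j) * fourierCoeffOn zero_lt_one u j := by
  have key : HasSum (fun j => ∫ x in (0 : ℝ)..1, cexp (-(2 * π * I * k * x)) *
      (u x * (a j * cexp (2 * π * I * j * x))))
      (∫ x in (0 : ℝ)..1, cexp (-(2 * π * I * k * x)) *
        (u x * ∑' j, a j * cexp (2 * π * I * j * x))) := by
    refine intervalIntegral.hasSum_integral_of_dominated_convergence
      (fun j x => ‖u x‖ * ‖a j‖) (fun j => ?_) (fun j => .of_forall fun x _ => ?_)
      (.of_forall fun x _ => ha.norm.mul_left _) ?_ (.of_forall fun x _ => ?_)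
    · exact Continuous.aestronglyMeasurable (by fun_prop)
    · have := norm_char_neg k x
      push_cast at this
      rw [norm_mul, norm_mul, norm_mul, norm_char_int, this, one_mul, mul_one]
    · simp only [tsum_mul_left]
      exact (hu.norm.mul continuous_const).intervalIntegrable _ _
    · have hs : Summable fun j : ℤ => a j * cexp (2 * π * I * j * x) :=
        Summable.of_norm (ha.norm.congr fun j => by rw [norm_mul, norm_char_int, mul_one])
      exact (hs.hasSum.mul_left _).mul_left _
  rw [fourierCoeffOn_zero_one, ← key.tsum_eq, ← (Equiv.subLeft k).tsum_eq]
  refine tsum_congr fun j => ?_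
  rw [fourierCoeffOn_zero_one, ← intervalIntegral.integral_const_mul]
  refine intervalIntegral.integral_congr fun x _ => ?_
  simp only [Equiv.subLeft_apply]
  rw [show (-(2 * π * I * j * x) : ℂ) = -(2 * π * I * k * x) + 2 * π * I * (k - j : ℤ) * x by
    push_cast; ring, Complex.exp_add]
  ring

theorem tsum_enorm_sq_fourierCoeffOn {f : ℝ → ℂ} (hf : Continuous f) :
    ∑' k, ‖fourierCoeffOn zero_lt_one f k‖ₑ ^ 2 =
      ENNReal.ofReal (∫ x in (0 : ℝ)..1, ‖f x‖ ^ 2) := by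
  have hm : MemLp f 2 (volume.restrict (Set.Ioc 0 1)) :=
    (memLp_two_iff_integrable_sq_norm hf.aestronglyMeasurable).2
      (((by fun_prop : Continuous fun x => ‖f x‖ ^ 2).integrableOn_Icc).mono_set
        Set.Ioc_subset_Icc_self)
  have h := hasSum_sq_fourierCoeffOn zero_lt_one hm
  rw [sub_zero, inv_one, one_smul] at h
  rw [← h.tsum_eq, ENNReal.ofReal_tsum_of_nonneg (fun _ => by positivity) h.summable]
  simp only [← ofReal_norm, ENNReal.ofReal_pow (norm_nonneg _)]

/-- Discrete convolution with the Fourier coefficients of a bounded function is bounded on `ℓ²`. -/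
theorem tsum_enorm_sq_conv_fourierCoeffOn_le {u : ℝ → ℂ} (hu : Continuous u) {M : ℝ}
    (hM : ∀ x ∈ Set.Icc (0 : ℝ) 1, ‖u x‖ ≤ M) {a : ℤ → ℂ} (ha : Summable a) :
    ∑' k, ‖∑' j, a (k - j) * fourierCoeffOn zero_lt_one u j‖ₑ ^ 2 ≤
      ENNReal.ofReal (M ^ 2) * ∑' k, ‖a k‖ₑ ^ 2 := by
  have hA : Continuous fun x : ℝ => ∑' j, a j * cexp (2 * π * I * j * x) :=
    continuous_tsum (fun j => by fun_prop) ha.norm fun j x => by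
      rw [norm_mul, norm_char_int, mul_one]
  -- The product formula with `u = 1`, whose only nonzero Fourier coefficient has index 0.
  have h1 : ∀ k, fourierCoeffOn zero_lt_one (fun x : ℝ => ∑' j, a j * cexp (2 * π * I * j * x)) k
      = a k := fun k => by
    have := fourierCoeffOn_mul_tsum (u := fun _ => 1) continuous_const ha k
    simp only [one_mul] at this
    rw [this, tsum_eq_single 0]
    · simp [fourierCoeffOn_zero_one]
    · intro j hj
      have hj' : (2 * π * I * (-j) : ℂ) ≠ 0 := by
        simp [Real.pi_ne_zero, I_ne_zero, hj]
      have h := integral_exp_mul_complex (a := 0) (b := 1) hj'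
      simp only [ofReal_one, ofReal_zero, mul_one, mul_zero, Complex.exp_zero] at h
      rw [show (2 * π * I * (-j) : ℂ) = (-j : ℤ) * (2 * π * I) by push_cast; ring,
        Complex.exp_int_mul_two_pi_mul_I, sub_self, zero_div] at h
      rw [fourierCoeffOn_zero_one]
      refine mul_eq_zero_of_right _ (Eq.trans ?_ h)
      refine intervalIntegral.integral_congr fun x _ => ?_
      simp only [mul_one]
      congr 1
      push_cast
      ring
  -- The convolution is now the coefficient sequence of `u · A`, with `A` the series of coefficients
  -- `a`; Parseval on both sides leaves the pointwise bound `|uA| ≤ M|A|` on `[0, 1]`.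
  simp only [← fourierCoeffOn_mul_tsum hu ha]
  have e₁ := tsum_enorm_sq_fourierCoeffOn
    (f := fun x : ℝ => u x * ∑' j, a j * cexp (2 * π * I * j * x)) (hu.mul hA)
  have e₂ := tsum_enorm_sq_fourierCoeffOn hA
  simp only [h1] at e₂
  rw [e₁, e₂, ← ENNReal.ofReal_mul (by positivity)]
  refine ENNReal.ofReal_le_ofReal ?_
  rw [← intervalIntegral.integral_const_mul]
  refine intervalIntegral.integral_mono_on zero_le_one
    (Continuous.intervalIntegrable (by fun_prop) _ _)
    (Continuous.intervalIntegrable (by fun_prop) _ _) fun x hx => ?_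
  rw [norm_mul, mul_pow]
  exact mul_le_mul_of_nonneg_right (pow_le_pow_left₀ (norm_nonneg _) (hM x hx) 2) (sq_nonneg _)

theorem fourierCoeffOn_exp {z : ℂ} (hz : z.im ≠ 0) (n : ℤ) :
    fourierCoeffOn zero_lt_one (fun x : ℝ => 2 * π * I / (1 - cexp (2 * π * I * z)) *
      cexp (2 * π * I * x * z)) n = 1 / (n - z) := by
  have hz' : z - n ≠ 0 := fun h => hz (by simpa using congrArg Complex.im h)
  have hz'' : n - z ≠ 0 := by rwa [← neg_sub, neg_ne_zero]
  have h1 : 1 - cexp (2 * π * I * z) ≠ 0 :=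
    sub_ne_zero.2 (exp_two_pi_mul_I_mul_ne_one hz).symm
  have hpi : (π : ℂ) ≠ 0 := by exact_mod_cast Real.pi_ne_zero
  rw [fourierCoeffOn_zero_one]
  simp only [mul_left_comm (cexp (-_)) _ _]
  rw [intervalIntegral.integral_const_mul, integral_char_mul_exp hz]
  field_simp
  ring

/-- The sequence `1 / (j/β - 2iw)` is not summable, so Young's inequality does not apply. It is
however the coefficient sequence of a multiple of `e^{2πixz}` on `[0, 1]` with `z = 2iwβ`, and the
squared supremum of that function serves as the constant. -/
theorem exists_tsum_enorm_sq_conv_le {β w : ℝ} (hβ : 0 < β) (hw : w ≠ 0) :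
    ∃ M : ℝ, ∀ a : ℤ → ℂ, Summable a →
      ∑' k, ‖∑' j : ℤ, a (k - j) * (1 / ((j / β : ℝ) - 2 * I * w : ℂ))‖ₑ ^ 2 ≤
        ENNReal.ofReal M * ∑' k, ‖a k‖ₑ ^ 2 := by
  have hz : (2 * I * w * β : ℂ).im ≠ 0 := by simp [hw, hβ.ne']
  have hβ' : (β : ℂ) ≠ 0 := by exact_mod_cast hβ.ne'
  set u : ℝ → ℂ := fun x : ℝ => β * (2 * π * I / (1 - cexp (2 * π * I * (2 * I * w * β))) *
      cexp (2 * π * I * x * (2 * I * w * β))) with hu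
  have huc : Continuous u := by fun_prop
  obtain ⟨M, hM⟩ := isCompact_Icc.exists_bound_of_continuousOn (s := Set.Icc (0 : ℝ) 1)
    huc.continuousOn
  refine ⟨M ^ 2, fun a ha => ?_⟩
  convert tsum_enorm_sq_conv_fourierCoeffOn_le huc hM ha using 8 with k j
  have := fourierCoeffOn_exp hz j
  rw [fourierCoeffOn_zero_one] at this
  rw [fourierCoeffOn_zero_one]
  simp only [hu, mul_left_comm (cexp (-_)) (β : ℂ) _]
  rw [intervalIntegral.integral_const_mul, this]
  push_cast
  rw [show (j / β - 2 * I * w : ℂ) = (j - 2 * I * w * β) / β by field_simp, one_div_div]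
  ring

/-! ### The Dirac comb and Poisson summation -/

theorem summable_inv_one_add_abs_sq {β : ℝ} (hβ : 0 < β) :
    Summable fun j : ℤ => ((1 + |(j : ℝ) / β|) ^ 2)⁻¹ := by
  obtain ⟨K, -, hK⟩ := exists_inv_sq_add_sq_le (inv_ne_zero hβ.ne') one_ne_zero 0
  refine Summable.of_nonneg_of_le (fun j => by positivity) (fun j => ?_)
    (summable_inv_one_add_int_sq.mul_left K)
  refine le_trans (inv_anti₀ (by positivity) ?_) (hK 0 (by simp) j)
  have h : (β⁻¹ * j) = (j : ℝ) / β := by ring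
  rw [h, zero_sub, neg_sq, one_pow, ← sq_abs]
  nlinarith [abs_nonneg ((j : ℝ) / β)]

/-- Quadratic decay controlled by finitely many seminorms, which makes the comb continuous on
Schwartz functions. The factor `4` is `2 ^ 2` from the comparison of `(1 + |x|)²` with the
seminorms. -/
theorem SchwartzMap.norm_apply_le_sup_seminorm (φ : 𝓢(ℝ, ℂ)) (x : ℝ) :
    ‖φ x‖ ≤ ((1 + |x|) ^ 2)⁻¹ *
      (4 * (Finset.Iic (2, 0)).sup (schwartzSeminormFamily ℂ ℝ ℂ) φ) := by
  have h := one_add_le_sup_seminorm_apply (𝕜 := ℂ) (m := (2, 0)) le_rfl le_rfl φ x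
  rw [norm_iteratedFDeriv_zero, Real.norm_eq_abs] at h
  rw [inv_mul_eq_div, le_div_iff₀ (by positivity), mul_comm]
  refine h.trans (le_of_eq ?_)
  norm_num
  rfl

theorem SchwartzMap.summable_apply_div (φ : 𝓢(ℝ, ℂ)) {β : ℝ} (hβ : 0 < β) :
    Summable fun j : ℤ => φ (j / β) :=
  Summable.of_norm_bounded ((summable_inv_one_add_abs_sq hβ).mul_right _) fun _ =>
    φ.norm_apply_le_sup_seminorm _

/-- The functional `φ ↦ β⁻¹ ∑_{j ∈ ℤ} φ (j / β)` on Schwartz functions. -/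
noncomputable def combCLM {β : ℝ} (hβ : 0 < β) : 𝓢(ℝ, ℂ) →L[ℂ] ℂ :=
  mkCLMtoNormedSpace (fun φ => (β : ℂ)⁻¹ * ∑' j : ℤ, φ (j / β))
    (fun φ ψ => by
      simp only [add_apply]
      rw [(φ.summable_apply_div hβ).tsum_add (ψ.summable_apply_div hβ), mul_add])
    (fun c φ => by
      simp only [smul_apply, smul_eq_mul, RingHom.id_apply, tsum_mul_left]
      ring)
    (by
      refine ⟨Finset.Iic (2, 0), β⁻¹ * ((∑' j : ℤ, ((1 + |(j : ℝ) / β|) ^ 2)⁻¹) * 4),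
        by positivity, fun φ => ?_⟩
      rw [norm_mul, norm_inv, norm_real, Real.norm_of_nonneg hβ.le, mul_assoc, mul_assoc]
      refine mul_le_mul_of_nonneg_left ?_ (by positivity)
      exact tsum_of_norm_bounded ((summable_inv_one_add_abs_sq hβ).hasSum.mul_right _) fun _ =>
        φ.norm_apply_le_sup_seminorm _)

/-- The Dirac comb `β⁻¹ ∑_{j ∈ ℤ} δ_{j / β}`. -/
noncomputable def combDist {β : ℝ} (hβ : 0 < β) : 𝓢'(ℝ, ℂ) :=
  ContinuousLinearMap.toPointwiseConvergenceCLM _ _ _ _ (combCLM hβ)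

theorem combDist_apply {β : ℝ} (hβ : 0 < β) (φ : 𝓢(ℝ, ℂ)) :
    combDist hβ φ = (β : ℂ)⁻¹ * ∑' j : ℤ, φ (j / β) := rfl

theorem charDist_apply (c : ℝ) (φ : 𝓢(ℝ, ℂ)) :
    charDist c φ = ∫ x, φ x * cexp (2 * π * I * c * x) :=
  Function.HasTemperateGrowth.toTemperedDistribution_apply _ (hasTemperateGrowth_char c) φ

/-- The rescaled Schwartz function `x ↦ φ (x / β)`. -/
noncomputable def SchwartzMap.compDiv {β : ℝ} (hβ : 0 < β) (φ : 𝓢(ℝ, ℂ)) : 𝓢(ℝ, ℂ) :=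
  compCLMOfAntilipschitz ℂ (g := fun x : ℝ => β⁻¹ * x) (K := β.toNNReal) (by fun_prop)
    (AntilipschitzWith.of_le_mul_dist fun s t => by
      rw [Real.dist_eq, Real.dist_eq, ← mul_sub, abs_mul, Real.coe_toNNReal _ hβ.le,
        abs_of_pos (inv_pos.2 hβ), mul_inv_cancel_left₀ hβ.ne']) φ

theorem SchwartzMap.compDiv_apply {β : ℝ} (hβ : 0 < β) (φ : 𝓢(ℝ, ℂ)) (x : ℝ) :
    φ.compDiv hβ x = φ (β⁻¹ * x) := rfl

-- Poisson summation is available over `ℤ`; rescaling carries the lattice `β⁻¹ℤ` to it.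
open FourierTransform in
theorem SchwartzMap.fourier_compDiv {β : ℝ} (hβ : 0 < β) (φ : 𝓢(ℝ, ℂ)) (m : ℤ) :
    𝓕 (φ.compDiv hβ) (m : ℝ) = β * charDist (-m * β) φ := by
  rw [charDist_apply, fourier_coe, Real.fourier_eq']
  have h := Measure.integral_comp_mul_left
    (fun y : ℝ => φ y * cexp (2 * π * I * (-m * β : ℝ) * y)) β⁻¹
  rw [inv_inv, abs_of_pos hβ, real_smul] at h
  rw [← h]
  refine integral_congr_ae (.of_forall fun x => ?_)
  have hβ' : (β : ℂ) ≠ 0 := by exact_mod_cast hβ.ne'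
  simp only [compDiv_apply, smul_eq_mul]
  rw [mul_comm]
  congr 2
  simp
  field_simp

-- Poisson summation for the rescaled function. The Schwartz decay of its Fourier transform makes
-- the sum over `m` absolutely convergent, hence unconditional.
open FourierTransform in
theorem hasSum_charDist_apply {β : ℝ} (hβ : 0 < β) (φ : 𝓢(ℝ, ℂ)) :
    HasSum (fun m : ℤ => charDist (m * β) φ) (combDist hβ φ) := by
  have hβ' : (β : ℂ) ≠ 0 := by exact_mod_cast hβ.ne'
  have hs : Summable fun m : ℤ => charDist (m * β) φ := by
    have := ((𝓕 (φ.compDiv hβ)).summable_apply_div one_pos).mul_left (β : ℂ)⁻¹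
    simp only [div_one, fourier_compDiv, inv_mul_cancel_left₀ hβ'] at this
    refine (Equiv.neg ℤ).summable_iff.1 (this.congr fun m => ?_)
    simp
  convert hs.hasSum using 1
  have h := SchwartzMap.tsum_eq_tsum_fourier (φ.compDiv hβ) 0
  simp only [zero_add, fourier_compDiv, compDiv_apply] at h
  rw [combDist_apply, inv_mul_eq_iff_eq_mul₀ hβ', ← tsum_mul_left,
    ← (Equiv.neg ℤ).tsum_eq (fun m : ℤ => (β : ℂ) * charDist (m * β) φ)]
  convert h using 3 with j j
  · congr 1
    ring
  · simp

theorem hasSum_charDist {β : ℝ} (hβ : 0 < β) :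
    HasSum (fun m : ℤ => charDist (m * β)) (combDist hβ) := by
  refine PointwiseConvergenceCLM.tendsto_iff_forall_tendsto.2 fun φ => ?_
  refine (hasSum_charDist_apply hβ φ).congr fun s => ?_
  exact (map_sum (PointwiseConvergenceCLM.evalCLM (RingHom.id ℂ) ℂ φ)
    (fun m : ℤ => charDist (m * β)) s).symm

/-- The distribution `h` is a weighted Dirac comb. -/
theorem hDist_apply {β w : ℝ} (hβ : 0 < β) (hw : w ≠ 0) (φ : 𝓢(ℝ, ℂ)) :
    hDist β w φ = (β : ℂ)⁻¹ * ∑' j : ℤ, 1 / ((j / β : ℝ) - 2 * I * w : ℂ) * φ (j / β) := by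
  rw [hDist, (hasSum_charDist hβ).tsum_eq, TemperedDistribution.smulLeftCLM_apply_apply,
    combDist_apply]
  simp only [SchwartzMap.smulLeftCLM_apply_apply (hasTemperateGrowth_inv_sub hw), smul_eq_mul]

theorem schwartzConv_smulLeftCLM_hDist {β w : ℝ} (hβ : 0 < β) (hw : w ≠ 0) {u : ℝ → ℂ}
    (hu : u.HasTemperateGrowth) (φ : 𝓢(ℝ, ℂ)) (x : ℝ) :
    schwartzConv (TemperedDistribution.smulLeftCLM ℂ u (hDist β w)) φ x =
      (β : ℂ)⁻¹ * ∑' j : ℤ, 1 / ((j / β : ℝ) - 2 * I * w : ℂ) * (u (j / β) * φ (x - j / β)) := by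
  rw [schwartzConv, TemperedDistribution.smulLeftCLM_apply_apply, hDist_apply hβ hw]
  simp only [SchwartzMap.smulLeftCLM_apply_apply hu, smul_eq_mul, reflectAt_apply]

theorem schwartzConv_hDist {β w : ℝ} (hβ : 0 < β) (hw : w ≠ 0) (φ : 𝓢(ℝ, ℂ)) (x : ℝ) :
    schwartzConv (hDist β w) φ x =
      (β : ℂ)⁻¹ * ∑' j : ℤ, 1 / ((j / β : ℝ) - 2 * I * w : ℂ) * φ (x - j / β) := by
  rw [schwartzConv, hDist_apply hβ hw]
  simp only [reflectAt_apply]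

/-- Poisson summation applied to `t ↦ φ (x - t)`: the periodization of `φ` recovered from samples of
its Fourier transform. This is what evaluates the sum over modulations. -/
theorem hasSum_charDist_reflectAt {β : ℝ} (hβ : 0 < β) (φ : 𝓢(ℝ, ℂ)) (x : ℝ) :
    HasSum (fun m : ℤ => cexp (2 * π * I * (m * β : ℝ) * x) *
      ∫ t, φ t * cexp (-(2 * π * I * (m * β : ℝ) * t)))
      ((β : ℂ)⁻¹ * ∑' j : ℤ, φ (x - j / β)) := by
  have h := hasSum_charDist_apply hβ (reflectAt φ x)
  simp only [combDist_apply, reflectAt_apply, charDist_apply] at h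
  convert h using 2 with m
  rw [← integral_sub_left_eq_self _ volume x, ← integral_const_mul]
  refine integral_congr_ae (.of_forall fun t => ?_)
  simp only []
  rw [mul_left_comm, ← Complex.exp_add]
  congr 2
  push_cast
  ring

/-! ### Boundedness on `L²` of convolution with `h` -/

theorem lintegral_eq_lintegral_tsum_translates {p : ℝ} (hp : 0 < p) {F : ℝ → ℝ≥0∞}
    (hF : Measurable F) :
    ∫⁻ x, F x = ∫⁻ y in Set.Ioc 0 p, ∑' k : ℤ, F (y + k * p) := by
  rw [← setLIntegral_univ, ← iUnion_Ioc_zsmul hp,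
    lintegral_iUnion (fun _ => measurableSet_Ioc) (Set.pairwise_disjoint_Ioc_zsmul p),
    lintegral_tsum (f := fun (k : ℤ) y => F (y + k * p)) fun k => by fun_prop]
  refine tsum_congr fun k => ?_
  rw [← (measurePreserving_add_right volume (k * p : ℝ)).setLIntegral_comp_preimage_emb
    (measurableEmbedding_addRight _)]
  congr 2
  ext x
  simp only [Set.mem_preimage, Set.mem_Ioc, zsmul_eq_mul]
  push_cast
  constructor <;> rintro ⟨h, h'⟩ <;> constructor <;> linarith

theorem measurable_schwartzConv_hDist {β w : ℝ} (hβ : 0 < β) (hw : w ≠ 0) (φ : 𝓢(ℝ, ℂ)) :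
    Measurable (schwartzConv (hDist β w) φ) := by
  simp only [funext (schwartzConv_hDist hβ hw φ)]
  refine (Measurable.tsum fun j => ?_).const_mul _
  exact (φ.continuous.measurable.comp (measurable_id.sub_const _)).const_mul _

/-- The comb couples `x` only with points of `x + β⁻¹ℤ`, so on every coset the convolution is a
discrete one. Its `ℓ²` bound is the same for all cosets and is integrated over the representatives
in `(0, β⁻¹]`. -/
theorem exists_lintegral_schwartzConv_hDist_le {β w : ℝ} (hβ : 0 < β) (hw : w ≠ 0) :
    ∃ M : ℝ, ∀ φ : 𝓢(ℝ, ℂ), ∫⁻ x, ‖schwartzConv (hDist β w) φ x‖ₑ ^ 2 ≤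
      ENNReal.ofReal M * ∫⁻ x, ‖φ x‖ₑ ^ 2 := by
  obtain ⟨M, hM⟩ := exists_tsum_enorm_sq_conv_le hβ hw
  refine ⟨(β⁻¹) ^ 2 * M, fun φ => ?_⟩
  have hβ' : 0 < β⁻¹ := inv_pos.2 hβ
  rw [lintegral_eq_lintegral_tsum_translates hβ'
      ((measurable_schwartzConv_hDist hβ hw φ).enorm.pow_const 2),
    lintegral_eq_lintegral_tsum_translates hβ' (φ.continuous.measurable.enorm.pow_const 2),
    ← lintegral_const_mul' _ _ ENNReal.ofReal_ne_top]
  refine lintegral_mono fun y => ?_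
  have hs : Summable fun k : ℤ => φ (y + k * β⁻¹) := by
    refine (Equiv.neg ℤ).summable_iff.1 (((reflectAt φ y).summable_apply_div hβ).congr fun k => ?_)
    simp [reflectAt_apply, sub_eq_add_neg, neg_mul, div_eq_mul_inv]
  refine le_trans (le_of_eq ?_) (mul_le_mul_right (hM _ hs) (ENNReal.ofReal (β⁻¹ ^ 2))) |>.trans
    (le_of_eq ?_)
  · rw [← ENNReal.tsum_mul_left]
    refine tsum_congr fun k => ?_
    rw [schwartzConv_hDist hβ hw, enorm_mul, mul_pow]
    congr 1
    · rw [← ofReal_norm, norm_inv, norm_real, Real.norm_of_nonneg hβ.le,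
        ENNReal.ofReal_pow hβ'.le]
    · refine congrArg (fun z : ℂ => ‖z‖ₑ ^ 2) (tsum_congr fun j => ?_)
      rw [mul_comm]
      congr 2
      push_cast
      ring
  · rw [← mul_assoc, ENNReal.ofReal_mul (by positivity)]

theorem eLpNorm_two_le_of_lintegral_le {f g : ℝ → ℂ} {M : ℝ≥0∞}
    (h : ∫⁻ x, ‖f x‖ₑ ^ 2 ≤ M * ∫⁻ x, ‖g x‖ₑ ^ 2) :
    eLpNorm f 2 volume ≤ M ^ (1 / 2 : ℝ) * eLpNorm g 2 volume := by
  have key : ∀ f : ℝ → ℂ, eLpNorm f 2 volume = (∫⁻ x, ‖f x‖ₑ ^ 2) ^ (1 / 2 : ℝ) := fun f => by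
    rw [eLpNorm_eq_lintegral_rpow_enorm_toReal two_ne_zero ENNReal.ofNat_ne_top]
    simp
  rw [key, key, ← ENNReal.mul_rpow_of_nonneg _ _ (by norm_num)]
  exact ENNReal.rpow_le_rpow h (by norm_num)

theorem schwartzConv_add_right (T : 𝓢'(ℝ, ℂ)) (φ ψ : 𝓢(ℝ, ℂ)) (x : ℝ) :
    schwartzConv T (φ + ψ) x = schwartzConv T φ x + schwartzConv T ψ x := by
  simp [schwartzConv, reflectAt]

theorem schwartzConv_smul_right (T : 𝓢'(ℝ, ℂ)) (c : ℂ) (φ : 𝓢(ℝ, ℂ)) (x : ℝ) :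
    schwartzConv T (c • φ) x = c * schwartzConv T φ x := by
  simp [schwartzConv, reflectAt]

/-- An `L²` bound on Schwartz functions makes a distribution an `L²`-convolutor. -/
theorem isL2Convolutor_of_lintegral_le {T : 𝓢'(ℝ, ℂ)}
    (hT : ∀ φ, AEStronglyMeasurable (schwartzConv T φ) volume) {M : ℝ≥0∞} (hM : M ≠ ∞)
    (h : ∀ φ : 𝓢(ℝ, ℂ), ∫⁻ x, ‖schwartzConv T φ x‖ₑ ^ 2 ≤ M * ∫⁻ x, ‖φ x‖ₑ ^ 2) :
    IsL2Convolutor T := by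
  have hM' : M ^ (1 / 2 : ℝ) ≠ ∞ := ENNReal.rpow_ne_top_of_nonneg (by norm_num) hM
  have hm : ∀ φ, MemLp (schwartzConv T φ) 2 volume := fun φ =>
    ⟨hT φ, (eLpNorm_two_le_of_lintegral_le (h φ)).trans_lt
      (ENNReal.mul_lt_top hM'.lt_top (φ.memLp 2 volume).2)⟩
  let A : 𝓢(ℝ, ℂ) →ₗ[ℂ] Lp ℂ 2 (volume : Measure ℝ) :=
    { toFun := fun φ => (hm φ).toLp _
      map_add' := fun φ ψ => by
        rw [← MemLp.toLp_add]
        exact MemLp.toLp_congr _ _ (.of_forall fun x => schwartzConv_add_right T φ ψ x)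
      map_smul' := fun c φ => by
        rw [RingHom.id_apply, ← MemLp.toLp_const_smul]
        exact MemLp.toLp_congr _ _ (.of_forall fun x => schwartzConv_smul_right T c φ x) }
  let e : 𝓢(ℝ, ℂ) →ₗ[ℂ] Lp ℂ 2 (volume : Measure ℝ) := (toLpCLM ℂ ℂ 2 volume).toLinearMap
  have he : DenseRange e := denseRange_toLpCLM (E := ℝ) (F := ℂ) (p := 2) (μ := volume) (by simp)
  have hA : ∃ C, ∀ φ, ‖A φ‖ ≤ C * ‖e φ‖ := by
    refine ⟨(M ^ (1 / 2 : ℝ)).toReal, fun φ => ?_⟩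
    change ‖(hm φ).toLp _‖ ≤ _ * ‖(φ.memLp 2 volume).toLp _‖
    rw [Lp.norm_toLp, Lp.norm_toLp, ← ENNReal.toReal_mul]
    exact ENNReal.toReal_mono (ENNReal.mul_ne_top hM' (φ.memLp 2 volume).2.ne)
      (eLpNorm_two_le_of_lintegral_le (h φ))
  refine ⟨A.extendOfNorm e, fun φ => ?_⟩
  have := LinearMap.extendOfNorm_eq he hA φ
  change A.extendOfNorm e (φ.toLp 2 volume) = (hm φ).toLp _ at this
  rw [this]
  exact (hm φ).coeFn_toLp

theorem isL2Convolutor_hDist {β w : ℝ} (hβ : 0 < β) (hw : w ≠ 0) :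
    IsL2Convolutor (hDist β w) := by
  obtain ⟨M, hM⟩ := exists_lintegral_schwartzConv_hDist_le hβ hw
  exact isL2Convolutor_of_lintegral_le
    (fun φ => (measurable_schwartzConv_hDist hβ hw φ).aestronglyMeasurable)
    ENNReal.ofReal_ne_top hM

/-- Multiplication by a bounded continuous function, as an operator on `L²(ℝ)`. -/
noncomputable def mulL2 (u : ℝ → ℂ) (hu : Continuous u) (C : ℝ) (hC : ∀ x, ‖u x‖ ≤ C) :
    Lp ℂ 2 (volume : Measure ℝ) →L[ℂ] Lp ℂ 2 (volume : Measure ℝ) :=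
  LinearMap.mkContinuous
    { toFun := fun f => (memLp_mul_of_bounded hu C hC (Lp.memLp f)).toLp _
      map_add' := fun f g => by
        rw [← MemLp.toLp_add]
        refine MemLp.toLp_congr _ _ ?_
        filter_upwards [Lp.coeFn_add f g] with x hx
        simp only [hx, Pi.add_apply, add_mul]
      map_smul' := fun c f => by
        rw [RingHom.id_apply, ← MemLp.toLp_const_smul]
        refine MemLp.toLp_congr _ _ ?_
        filter_upwards [Lp.coeFn_smul c f] with x hx
        simp only [hx, Pi.smul_apply, smul_eq_mul, mul_assoc] } C fun f => by
    have hC0 : 0 ≤ C := (norm_nonneg _).trans (hC 0)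
    refine Lp.norm_le_mul_norm_of_ae_le_mul ?_
    filter_upwards [(memLp_mul_of_bounded hu C hC (Lp.memLp f)).coeFn_toLp] with x hx
    simp only [LinearMap.coe_mk, AddHom.coe_mk, hx, norm_mul]
    rw [mul_comm]
    exact mul_le_mul_of_nonneg_right (hC x) (norm_nonneg _)

theorem mulL2_ae {u : ℝ → ℂ} (hu : Continuous u) {C : ℝ} (hC : ∀ x, ‖u x‖ ≤ C)
    (f : Lp ℂ 2 (volume : Measure ℝ)) : mulL2 u hu C hC f =ᵐ[volume] fun x => f x * u x :=
  (memLp_mul_of_bounded hu C hC (Lp.memLp f)).coeFn_toLp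

theorem toL2_mul_eq {u : ℝ → ℂ} (hu : Continuous u) {C : ℝ} (hC : ∀ x, ‖u x‖ ≤ C)
    (f : Lp ℂ 2 (volume : Measure ℝ)) : toL2 (fun x => f x * u x) = mulL2 u hu C hC f := by
  rw [toL2, dif_pos (memLp_mul_of_bounded hu C hC (Lp.memLp f))]
  rfl

/-! ### Operations preserving convolutors -/

theorem IsConvolutionBy.add {T U : 𝓢'(ℝ, ℂ)}
    {C D : Lp ℂ 2 (volume : Measure ℝ) →L[ℂ] Lp ℂ 2 (volume : Measure ℝ)}
    (hC : IsConvolutionBy T C) (hD : IsConvolutionBy U D) : IsConvolutionBy (T + U) (C + D) := by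
  intro φ
  filter_upwards [hC φ, hD φ, Lp.coeFn_add (C (φ.toLp 2 volume)) (D (φ.toLp 2 volume))]
    with x h1 h2 h3
  rw [_root_.add_apply, h3, Pi.add_apply, h1, h2]
  rfl

theorem IsConvolutionBy.smul {T : 𝓢'(ℝ, ℂ)}
    {C : Lp ℂ 2 (volume : Measure ℝ) →L[ℂ] Lp ℂ 2 (volume : Measure ℝ)}
    (hC : IsConvolutionBy T C) (c : ℂ) : IsConvolutionBy (c • T) (c • C) := by
  intro φ
  filter_upwards [hC φ, Lp.coeFn_smul c (C (φ.toLp 2 volume))] with x h1 h2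
  rw [_root_.smul_apply, h2, Pi.smul_apply, h1]
  rfl

theorem isL2Convolutor_zero : IsL2Convolutor 0 :=
  ⟨0, fun _ => Lp.coeFn_zero ℂ 2 volume⟩

theorem IsL2Convolutor.sum {ι : Type*} {T : ι → 𝓢'(ℝ, ℂ)} (s : Finset ι)
    (h : ∀ i ∈ s, IsL2Convolutor (T i)) : IsL2Convolutor (∑ i ∈ s, T i) :=
  Finset.sum_induction T IsL2Convolutor (fun _ _ ⟨_, hC⟩ ⟨_, hD⟩ => ⟨_, hC.add hD⟩)
    isL2Convolutor_zero h

/-- Because `e^{2πics} = e^{2πicx} e^{-2πic(x - s)}`, multiplying the kernel by a character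
conjugates the convolution operator by a modulation. -/
theorem IsL2Convolutor.smulLeftCLM_char {T : 𝓢'(ℝ, ℂ)} (hT : IsL2Convolutor T) (c : ℝ) :
    IsL2Convolutor (TemperedDistribution.smulLeftCLM ℂ
      (fun s : ℝ => cexp (2 * π * I * c * s)) T) := by
  obtain ⟨C, hC⟩ := hT
  let M := fun c : ℝ => mulL2 (fun s : ℝ => cexp (2 * π * I * c * s)) (by fun_prop) 1
    fun x => (norm_char c x).le
  refine ⟨(M c).comp (C.comp (M (-c))), fun φ => ?_⟩
  set ψ : 𝓢(ℝ, ℂ) := SchwartzMap.smulLeftCLM ℂ (fun s : ℝ => cexp (2 * π * I * (-c : ℝ) * s)) φ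
    with hψ
  have hψx : ∀ x, ψ x = cexp (2 * π * I * (-c : ℝ) * x) * φ x := fun x =>
    SchwartzMap.smulLeftCLM_apply_apply (hasTemperateGrowth_char (-c)) φ x
  have h1 : M (-c) (φ.toLp 2 volume) = ψ.toLp 2 volume := by
    refine Lp.ext ?_
    filter_upwards [mulL2_ae (u := fun s : ℝ => cexp (2 * π * I * (-c : ℝ) * s)) (by fun_prop)
      (fun x => (norm_char (-c) x).le) (φ.toLp 2 volume), φ.coeFn_toLp 2 volume,
      ψ.coeFn_toLp 2 volume] with x h1 h2 h3
    rw [h3, hψx, mul_comm, ← h2]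
    exact h1
  rw [ContinuousLinearMap.comp_apply, ContinuousLinearMap.comp_apply, h1]
  filter_upwards [mulL2_ae (u := fun s : ℝ => cexp (2 * π * I * c * s)) (by fun_prop)
      (fun x => (norm_char c x).le) (C (ψ.toLp 2 volume)), hC ψ] with x h2 h3
  refine h2.trans ?_
  rw [h3, schwartzConv, schwartzConv, TemperedDistribution.smulLeftCLM_apply_apply, mul_comm,
    ← smul_eq_mul, ← map_smul]
  congr 1
  ext t
  rw [SchwartzMap.smulLeftCLM_apply_apply (hasTemperateGrowth_char c), smul_apply, reflectAt_apply,
    reflectAt_apply, hψx, smul_eq_mul, smul_eq_mul, ← mul_assoc, ← Complex.exp_add]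
  congr 2
  push_cast
  ring

theorem IsL2Convolutor.smulLeftCLM_trig {N : ℕ} {T : 𝓢'(ℝ, ℂ)} (hT : IsL2Convolutor T)
    (c d : Fin N → Fin N → ℂ) (e : Fin N → Fin N → ℝ) (r : Fin N → Fin N → Prop)
    [∀ k l, Decidable (r k l)] :
    IsL2Convolutor (TemperedDistribution.smulLeftCLM ℂ
      (fun s : ℝ => ∑ k, ∑ l with r k l, c k l * cexp (2 * π * I * e k l * s) * d k l) T) := by
  have hg : ∀ k l, (fun s : ℝ => c k l * cexp (2 * π * I * e k l * s) * d k l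
    ).HasTemperateGrowth := fun k l =>
    (((Function.HasTemperateGrowth.const _).mul (hasTemperateGrowth_char _)).mul
      (Function.HasTemperateGrowth.const _))
  rw [TemperedDistribution.smulLeftCLM_sum fun k _ => Function.HasTemperateGrowth.sum fun l _ =>
    hg k l, _root_.sum_apply]
  refine IsL2Convolutor.sum _ fun k _ => ?_
  rw [TemperedDistribution.smulLeftCLM_sum fun l _ => hg k l, _root_.sum_apply]
  refine IsL2Convolutor.sum _ fun l _ => ?_
  have h : (fun s : ℝ => c k l * cexp (2 * π * I * e k l * s) * d k l) =
      (c k l * d k l) • fun s : ℝ => cexp (2 * π * I * e k l * s) := by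
    funext s
    simp only [Pi.smul_apply, smul_eq_mul]
    ring
  rw [h, TemperedDistribution.smulLeftCLM_smul (hasTemperateGrowth_char _),
    _root_.smul_apply]
  obtain ⟨C, hC⟩ := hT.smulLeftCLM_char (e k l)
  exact ⟨_, hC.smul _⟩

/-! ### Closed form of the sum over time shifts -/

theorem im_add_I_mul_div_ne_zero {α c : ℝ} (hα : α ≠ 0) (hc : c ≠ 0) (t : ℝ) :
    ((t + I * c) / α : ℂ).im ≠ 0 := by
  rw [div_ofReal_im]
  simpa using ⟨hc, hα⟩

/-- The `n`-th term of the kernel of the frame operator of two modulated Cauchy kernels. -/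
noncomputable def cauchyTerm (α w b b' x s : ℝ) (n : ℤ) : ℂ :=
  cexp (2 * π * I * b' * (x - α * n : ℝ)) / ((x - α * n : ℝ) - I * w) *
    (cexp (-(2 * π * I * b * (x - s - α * n : ℝ))) / ((x - s - α * n : ℝ) + I * w))

/-- The two denominators differ by `s - 2iw`, independently of `n`, so partial fractions give the
difference of simple poles at `z₁ = (x - s + iw)/α` and `z₂ = (x - iw)/α`. The dependence of the
exponentials on `n` is `e^{2πinα(b - b')}`, which an integer `j` added to `α(b - b')` does not
change; `j` serves to bring the frequency into `[0, 1]`. -/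
theorem hasSum_cauchyTerm {α w : ℝ} (hα : 0 < α) (hw : w ≠ 0) (b b' x s : ℝ) (j : ℤ)
    (h0 : 0 ≤ α * (b - b') + j) (h1 : α * (b - b') + j ≤ 1) :
    HasSum (cauchyTerm α w b b' x s)
      (2 * π * I / α * (1 / (s - 2 * I * w)) *
        (cexp (2 * π * I * b' * x) * cexp (-(2 * π * I * b * (x - s : ℝ))) *
        (cexp (2 * π * I * (α * (b - b') + j) * (((x - s : ℝ) + I * w) / α)) /
            (cexp (2 * π * I * (((x - s : ℝ) + I * w) / α)) - 1) -
          cexp (2 * π * I * (α * (b - b') + j) * ((x - I * w) / α)) /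
            (cexp (2 * π * I * ((x - I * w) / α)) - 1)))) := by
  have hα' : (α : ℂ) ≠ 0 := by exact_mod_cast hα.ne'
  have hz₁ := im_add_I_mul_div_ne_zero hα.ne' hw (x - s)
  have hz₂ : ((x - I * w) / α : ℂ).im ≠ 0 := by
    simpa [sub_eq_add_neg] using im_add_I_mul_div_ne_zero hα.ne' (neg_ne_zero.2 hw) x
  have hs : (s - 2 * I * w : ℂ) ≠ 0 := fun h => hw (by simpa using congrArg Complex.im h)
  have h := (hasSum_char_mul_inv_sub_sub_inv_sub hz₁ hz₂ h0 h1).mul_left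
    (1 / (s - 2 * I * w) * (cexp (2 * π * I * b' * x) * cexp (-(2 * π * I * b * (x - s : ℝ)))) / α)
  convert h using 1
  · rfl
  · funext n
    have hA : ((x - α * n : ℝ) - I * w : ℂ) ≠ 0 := sub_mul_I_ne_zero hw _
    have hB : ((x - s - α * n : ℝ) + I * w : ℂ) ≠ 0 := by
      simpa using sub_mul_I_ne_zero (neg_ne_zero.2 hw) (x - s - α * n)
    have e₁ : 1 / ((((x - s : ℝ) + I * w) / α : ℂ) - n) = α / ((x - s - α * n : ℝ) + I * w) := by
      rw [← one_div_div _ (α : ℂ)]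
      congr 1
      push_cast
      field_simp
      ring
    have e₂ : 1 / (((x - I * w) / α : ℂ) - n) = α / ((x - α * n : ℝ) - I * w) := by
      rw [← one_div_div _ (α : ℂ)]
      congr 1
      push_cast
      field_simp
      ring
    have e₃ : α / ((x - s - α * n : ℝ) + I * w) - α / ((x - α * n : ℝ) - I * w) =
        α * (s - 2 * I * w) *
          (1 / ((x - α * n : ℝ) - I * w) * (1 / ((x - s - α * n : ℝ) + I * w)) : ℂ) := by
      rw [div_sub_div _ _ hB hA]
      field_simp
      push_cast
      ring
    have e₄ : cexp (2 * π * I * b' * (x - α * n : ℝ)) *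
        cexp (-(2 * π * I * b * (x - s - α * n : ℝ))) =
        cexp (2 * π * I * b' * x) * cexp (-(2 * π * I * b * (x - s : ℝ))) *
          cexp (2 * π * I * n * (α * (b - b') + j : ℝ)) := by
      have : cexp (2 * π * I * n * (α * (b - b') + j : ℝ)) =
          cexp (2 * π * I * n * (α * (b - b'))) := by
        rw [show (2 * π * I * n * (α * (b - b') + j : ℝ) : ℂ) =
          2 * π * I * n * (α * (b - b')) + (n * j : ℤ) * (2 * π * I) by push_cast; ring,
          Complex.exp_add, Complex.exp_int_mul_two_pi_mul_I, mul_one]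
      rw [this, ← Complex.exp_add, ← Complex.exp_add, ← Complex.exp_add]
      congr 1
      push_cast
      ring
    rw [e₁, e₂, e₃, cauchyTerm, div_mul_div_comm, e₄]
    field_simp
  · push_cast
    ring

theorem exp_div_exp_sub_one (z : ℂ) :
    cexp z / (cexp z - 1) = 1 / (1 - cexp (-z)) := by
  rw [Complex.exp_neg, ← mul_div_mul_left 1 _ (Complex.exp_ne_zero z), mul_sub, mul_one,
    mul_inv_cancel₀ (Complex.exp_ne_zero z)]

/-- All occurrences of `x` cancel. The exponentials thus depend on `s` alone and can be absorbed
into the convolution kernel; the shift `iw` produces the real exponential. -/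
theorem exp_mul_exp_mul_exp_fst {α : ℝ} (hα : α ≠ 0) (w b b' x s : ℝ) :
    cexp (2 * π * I * b' * x) * cexp (-(2 * π * I * b * (x - s : ℝ))) *
      cexp (2 * π * I * (α * (b - b')) * (((x - s : ℝ) + I * w) / α)) =
    cexp (2 * π * I * b' * s) * cexp (-(2 * π * w * (b - b'))) := by
  have hα' : (α : ℂ) ≠ 0 := by exact_mod_cast hα
  simp only [← Complex.exp_add]
  congr 1
  push_cast
  field_simp
  linear_combination (w * (b - b') : ℂ) * I_sq

theorem exp_mul_exp_mul_exp_snd {α : ℝ} (hα : α ≠ 0) (w b b' x s : ℝ) :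
    cexp (2 * π * I * b' * x) * cexp (-(2 * π * I * b * (x - s : ℝ))) *
      cexp (2 * π * I * (α * (b - b')) * ((x - I * w) / α)) =
    cexp (2 * π * I * b * s) * cexp (2 * π * w * (b - b')) := by
  have hα' : (α : ℂ) ≠ 0 := by exact_mod_cast hα
  simp only [← Complex.exp_add]
  congr 1
  push_cast
  field_simp
  linear_combination (-(w * (b - b')) : ℂ) * I_sq

theorem hasSum_cauchyTerm_of_gt {α w : ℝ} (hα : 0 < α) (hw : w ≠ 0) {b b' : ℝ} (x s : ℝ)
    (hb : b' < b) (h1 : α * |b - b'| ≤ 1) :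
    HasSum (cauchyTerm α w b b' x s)
      (2 * π * I / α * (1 / (s - 2 * I * w)) *
        (cexp (2 * π * I * b' * s) * cexp (-(2 * π * w * (b - b'))) /
            (cexp (2 * π * I * (((x - s : ℝ) + I * w) / α)) - 1) -
          1 / (cexp (2 * π * I * ((x - I * w) / α)) - 1) *
            (cexp (2 * π * I * b * s) * cexp (2 * π * w * (b - b'))))) := by
  rw [abs_of_pos (sub_pos.2 hb)] at h1
  convert hasSum_cauchyTerm hα hw b b' x s 0
    (by simpa using (mul_pos hα (sub_pos.2 hb)).le) (by simpa using h1) using 2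
  rw [← exp_mul_exp_mul_exp_fst hα.ne' w b b' x s, ← exp_mul_exp_mul_exp_snd hα.ne' w b b' x s,
    Int.cast_zero, add_zero]
  ring

/-- Here `α(b - b')` is negative and the representative is `α(b - b') + 1`. The additional factor
`e^{2πiz}` turns `1 / (e^{2πiz} - 1)` into `1 / (1 - e^{-2πiz})`. -/
theorem hasSum_cauchyTerm_of_lt {α w : ℝ} (hα : 0 < α) (hw : w ≠ 0) {b b' : ℝ} (x s : ℝ)
    (hb : b < b') (h1 : α * |b - b'| ≤ 1) :
    HasSum (cauchyTerm α w b b' x s)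
      (2 * π * I / α * (1 / (s - 2 * I * w)) *
        (cexp (2 * π * I * b' * s) * cexp (-(2 * π * w * (b - b'))) /
            (1 - cexp (-(2 * π * I * (((x - s : ℝ) + I * w) / α)))) -
          1 / (1 - cexp (-(2 * π * I * ((x - I * w) / α)))) *
            (cexp (2 * π * I * b * s) * cexp (2 * π * w * (b - b'))))) := by
  have hb' := mul_neg_of_pos_of_neg hα (sub_neg.2 hb)
  rw [abs_of_neg (sub_neg.2 hb)] at h1
  convert hasSum_cauchyTerm hα hw b b' x s 1
    (by push_cast; linarith) (by push_cast; linarith) using 2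
  have key : ∀ z : ℂ, cexp (2 * π * I * (α * (b - b') + (1 : ℤ)) * z) / (cexp (2 * π * I * z) - 1)
      = cexp (2 * π * I * (α * (b - b')) * z) * (1 / (1 - cexp (-(2 * π * I * z)))) := fun z => by
    rw [← exp_div_exp_sub_one, ← mul_div_assoc, ← Complex.exp_add]
    congr 2
    push_cast
    ring
  rw [key, key, ← exp_mul_exp_mul_exp_fst hα.ne' w b b' x s,
    ← exp_mul_exp_mul_exp_snd hα.ne' w b b' x s]
  ring

/-- The frequency is `θ = 0`, an endpoint at which the Fourier series still converges to the right
value. The modulations in `x` and `x - s` are kept apart, to act after and before the convolution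
with `h`. -/
theorem hasSum_cauchyTerm_of_eq {α w : ℝ} (hα : 0 < α) (hw : w ≠ 0) {b b' : ℝ} (x s : ℝ)
    (hb : b = b') :
    HasSum (cauchyTerm α w b b' x s)
      (2 * π * I / α * (1 / (s - 2 * I * w)) *
        (cexp (2 * π * I * b * x) * (cexp (-(2 * π * I * b * (x - s : ℝ))) /
            (cexp (2 * π * I * (((x - s : ℝ) + I * w) / α)) - 1) -
          1 / (cexp (2 * π * I * ((x - I * w) / α)) - 1) *
            cexp (-(2 * π * I * b * (x - s : ℝ)))))) := by
  subst hb
  convert hasSum_cauchyTerm hα hw b b x s 0 (by simp) (by simp) using 2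
  simp only [sub_self, mul_zero, Int.cast_zero, add_zero, zero_mul, Complex.exp_zero]
  ring

/-- The kernel of `α / (2πi)` times the frame operator. -/
noncomputable def gaborKernel (α : ℝ) {N : ℕ} (a : Fin N → ℂ) (b : Fin N → ℝ) (w x s : ℝ) : ℂ :=
  1 / (s - 2 * I * w) *
    (trigGtFst a b w s / (cexp (2 * π * I * (((x - s : ℝ) + I * w) / α)) - 1)
    - 1 / (cexp (2 * π * I * ((x - I * w) / α)) - 1) * trigGtSnd a b w s
    + trigLtFst a b w s / (1 - cexp (-(2 * π * I * (((x - s : ℝ) + I * w) / α))))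
    - 1 / (1 - cexp (-(2 * π * I * ((x - I * w) / α)))) * trigLtSnd a b w s
    + ∑ k, ∑ l with b k = b l, star (a k) * a l * cexp (2 * π * I * b k * x) *
      (cexp (-(2 * π * I * b k * (x - s : ℝ))) /
          (cexp (2 * π * I * (((x - s : ℝ) + I * w) / α)) - 1)
        - 1 / (cexp (2 * π * I * ((x - I * w) / α)) - 1) *
          cexp (-(2 * π * I * b k * (x - s : ℝ)))))

theorem star_trigCauchyWindow {N : ℕ} (a : Fin N → ℂ) (b : Fin N → ℝ) (w t : ℝ) :
    star (trigCauchyWindow a b w t) =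
      (∑ k, star (a k) * cexp (-(2 * π * I * b k * t))) / (t + I * w) := by
  simp only [trigCauchyWindow, Complex.star_def, map_div₀, map_sum, map_mul, map_sub,
    ← Complex.exp_conj, conj_ofReal, conj_I, map_ofNat]
  congr 1
  · refine Finset.sum_congr rfl fun k _ => ?_
    congr 2
    ring
  · ring

theorem trigCauchyWindow_mul_star {N : ℕ} (α : ℝ) (a : Fin N → ℂ) (b : Fin N → ℝ) (w x s : ℝ)
    (n : ℤ) :
    trigCauchyWindow a b w (x - α * n) * star (trigCauchyWindow a b w (x - s - α * n)) =
      ∑ k, ∑ l, star (a k) * a l * cauchyTerm α w (b k) (b l) x s n := by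
  rw [star_trigCauchyWindow, trigCauchyWindow, div_mul_div_comm, mul_comm (∑ k, _) (∑ k, _),
    Finset.sum_mul_sum, Finset.sum_div]
  refine Finset.sum_congr rfl fun k _ => ?_
  rw [Finset.sum_div]
  refine Finset.sum_congr rfl fun l _ => ?_
  rw [cauchyTerm, div_mul_div_comm]
  ring

theorem Finset.sum_eq_sum_lt_add_sum_gt_add_sum_eq {N : ℕ} (b : Fin N → ℝ) (k : Fin N)
    (F : Fin N → ℂ) :
    ∑ l, F l = ∑ l with b l < b k, F l + ∑ l with b k < b l, F l + ∑ l with b k = b l, F l := by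
  simp only [Finset.sum_filter, ← Finset.sum_add_distrib]
  refine Finset.sum_congr rfl fun l _ => ?_
  rcases lt_trichotomy (b l) (b k) with h | h | h
  · simp [h, h.not_gt, h.ne']
  · simp [h]
  · simp [h, h.not_gt, h.ne]

/-- The product expands over pairs `(k, l)`, and the order of `bₖ` and `bₗ` selects which of the
three closed forms applies. This evaluates the kernel of Walnut's representation. -/
theorem hasSum_trigCauchyWindow_mul_star {α w : ℝ} (hα : 0 < α) (hw : w ≠ 0) {N : ℕ}
    (a : Fin N → ℂ) (b : Fin N → ℝ) (hαb : ∀ k l, α * |b k - b l| ≤ 1) (x s : ℝ) :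
    HasSum (fun n : ℤ => trigCauchyWindow a b w (x - α * n) *
        star (trigCauchyWindow a b w (x - s - α * n)))
      (2 * π * I / α * gaborKernel α a b w x s) := by
  have hs : ∀ k l, Summable (cauchyTerm α w (b k) (b l) x s) := fun k l => by
    rcases lt_trichotomy (b l) (b k) with h | h | h
    · exact (hasSum_cauchyTerm_of_gt hα hw x s h (hαb k l)).summable
    · exact (hasSum_cauchyTerm_of_eq hα hw x s h.symm).summable
    · exact (hasSum_cauchyTerm_of_lt hα hw x s h (hαb k l)).summable
  have h : HasSum (fun n : ℤ => trigCauchyWindow a b w (x - α * n) *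
        star (trigCauchyWindow a b w (x - s - α * n)))
      (∑ k, ∑ l, star (a k) * a l * ∑' n, cauchyTerm α w (b k) (b l) x s n) := by
    simp only [trigCauchyWindow_mul_star]
    exact hasSum_sum fun k _ => hasSum_sum fun l _ => (hs k l).hasSum.mul_left _
  convert h using 1
  simp only [gaborKernel, trigGtFst, trigGtSnd, trigLtFst, trigLtSnd, Finset.sum_div,
    Finset.mul_sum, ← Finset.sum_sub_distrib, ← Finset.sum_add_distrib]
  refine Finset.sum_congr rfl fun k _ => ?_
  rw [Finset.sum_eq_sum_lt_add_sum_gt_add_sum_eq b k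
    (fun l => star (a k) * a l * ∑' n, cauchyTerm α w (b k) (b l) x s n)]
  have e₁ : ∀ l ∈ Finset.univ.filter (fun l => b l < b k), _ := fun l hl =>
    congrArg (star (a k) * a l * ·)
      (hasSum_cauchyTerm_of_gt hα hw x s (Finset.mem_filter.1 hl).2 (hαb k l)).tsum_eq
  have e₂ : ∀ l ∈ Finset.univ.filter (fun l => b k < b l), _ := fun l hl =>
    congrArg (star (a k) * a l * ·)
      (hasSum_cauchyTerm_of_lt hα hw x s (Finset.mem_filter.1 hl).2 (hαb k l)).tsum_eq
  have e₃ : ∀ l ∈ Finset.univ.filter (fun l => b k = b l), _ := fun l hl =>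
    congrArg (star (a k) * a l * ·)
      (hasSum_cauchyTerm_of_eq hα hw x s (Finset.mem_filter.1 hl).2).tsum_eq
  rw [Finset.sum_congr rfl e₁, Finset.sum_congr rfl e₂, Finset.sum_congr rfl e₃]
  have split : ∀ (c : ℂ) (A B : Finset (Fin N)) (f f' g' : Fin N → ℂ) (S : ℂ),
      c * (∑ l ∈ A, f l + ∑ l ∈ B, f' l - ∑ l ∈ B, g' l + S) =
        ∑ l ∈ A, c * f l + ∑ l ∈ B, c * (f' l - g' l) + c * S := by
    intro c A B f f' g' S
    simp only [← Finset.mul_sum, Finset.sum_sub_distrib]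
    ring
  rw [← mul_assoc, split, Finset.mul_sum]
  congr 1
  · congr 1 <;> refine Finset.sum_congr rfl fun l _ => ?_ <;> ring
  · refine Finset.sum_congr rfl fun l _ => ?_
    ring

/-! ### Bessel bounds and frame operators in a Hilbert space -/

section Bessel

variable {H : Type*} [NormedAddCommGroup H] [InnerProductSpace ℂ H]

/-- Synthesis is adjoint to analysis: expand `‖y‖²` as a pairing of the coefficients with the inner
products of `y`, apply Cauchy–Schwarz and the Bessel bound at `y`, and cancel `‖y‖²`. -/
theorem norm_sq_sum_smul_le_of_bessel {ι : Type*} {v : ι → H} {B : ℝ} (hB0 : 0 ≤ B)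
    (hB : ∀ (f : H) (s : Finset ι), ∑ i ∈ s, ‖inner ℂ (v i) f‖ ^ 2 ≤ B * ‖f‖ ^ 2)
    (c : ι → ℂ) (s : Finset ι) : ‖∑ i ∈ s, c i • v i‖ ^ 2 ≤ B * ∑ i ∈ s, ‖c i‖ ^ 2 := by
  set y := ∑ i ∈ s, c i • v i with hy
  have h1 : ‖y‖ ^ 2 ≤ ∑ i ∈ s, ‖c i‖ * ‖inner ℂ (v i) y‖ := by
    have h : inner ℂ y y = ∑ i ∈ s, c i * inner ℂ y (v i) := by
      conv_lhs => rw [hy, ← hy, inner_sum]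
      simp only [inner_smul_right]
    calc ‖y‖ ^ 2 = ‖inner ℂ y y‖ := by
          rw [inner_self_eq_norm_sq_to_K, norm_pow]
          simp
      _ ≤ _ := by
          rw [h]
          refine (norm_sum_le _ _).trans (le_of_eq (Finset.sum_congr rfl fun i _ => ?_))
          rw [norm_mul, norm_inner_symm]
  have h2 := Finset.sum_mul_sq_le_sq_mul_sq s (fun i => ‖c i‖) fun i => ‖inner ℂ (v i) y‖
  have h3 : (‖y‖ ^ 2) ^ 2 ≤ (∑ i ∈ s, ‖c i‖ ^ 2) * (B * ‖y‖ ^ 2) :=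
    (pow_le_pow_left₀ (by positivity) h1 2).trans
      (h2.trans (mul_le_mul_of_nonneg_left (hB y s) (by positivity)))
  rcases (norm_nonneg y).eq_or_lt with h | h
  · rw [← h, zero_pow two_ne_zero]
    positivity
  · have : 0 < ‖y‖ ^ 2 := by positivity
    nlinarith

theorem summable_inner_smul_of_bessel [CompleteSpace H] {ι : Type*} {v : ι → H} {B : ℝ}
    (hB0 : 0 ≤ B)
    (hB : ∀ (f : H) (s : Finset ι), ∑ i ∈ s, ‖inner ℂ (v i) f‖ ^ 2 ≤ B * ‖f‖ ^ 2) (f : H) :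
    Summable fun i => inner ℂ (v i) f • v i := by
  have hs : Summable fun i => ‖inner ℂ (v i) f‖ ^ 2 :=
    summable_of_sum_le (fun _ => by positivity) (hB f)
  rw [summable_iff_vanishing_norm] at hs ⊢
  intro ε hε
  -- `B + 1` in the denominator because `B` may vanish.
  obtain ⟨s, hs⟩ := hs (ε ^ 2 / (B + 1)) (by positivity)
  refine ⟨s, fun t ht => ?_⟩
  have h1 := hs t ht
  rw [Real.norm_of_nonneg (by positivity), lt_div_iff₀ (by positivity)] at h1
  have h2 := norm_sq_sum_smul_le_of_bessel hB0 hB (fun i => inner ℂ (v i) f) t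
  have h3 : 0 ≤ ∑ i ∈ t, ‖inner ℂ (v i) f‖ ^ 2 := by positivity
  exact lt_of_pow_lt_pow_left₀ 2 hε.le (by nlinarith)

/-- A Bessel bound follows from the weak identification of the frame operator on a dense set. -/
theorem bessel_of_weak {v : ℤ × ℤ → H} {S : H →L[ℂ] H} {D : Set H} (hD : Dense D)
    (h : ∀ f ∈ D, ∃ A : ℤ → ℂ,
      (∀ n, HasSum (fun m => inner ℂ (v (m, n)) f * inner ℂ f (v (m, n))) (A n)) ∧
        HasSum A (inner ℂ f (S f))) (f : H) (s : Finset (ℤ × ℤ)) :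
    ∑ p ∈ s, ‖inner ℂ (v p) f‖ ^ 2 ≤ ‖S‖ * ‖f‖ ^ 2 := by
  -- For a fixed finite `s` both sides are continuous in `f`, so the dense set suffices.
  have hcl : IsClosed {f : H | ∑ p ∈ s, ‖inner ℂ (v p) f‖ ^ 2 ≤ ‖S‖ * ‖f‖ ^ 2} :=
    isClosed_le (by fun_prop) (by fun_prop)
  refine hcl.closure_subset_iff.2 ?_ (hD f)
  intro f hf
  obtain ⟨A, hA, hA'⟩ := h f hf
  have e : ∀ p, inner ℂ (v p) f * inner ℂ f (v p) = ((‖inner ℂ (v p) f‖ ^ 2 : ℝ) : ℂ) := fun p => by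
    rw [← inner_conj_symm f (v p), mul_conj, normSq_eq_norm_sq]
  have hre : ∀ n, HasSum (fun m => ‖inner ℂ (v (m, n)) f‖ ^ 2) (A n).re := fun n => by
    have := hasSum_re (hA n)
    simpa only [e, ofReal_re] using this
  -- With `φ = f` the terms are nonnegative, so convergence of the iterated sums already gives
  -- summability over pairs.
  have hs : Summable fun q : ℤ × ℤ => ‖inner ℂ (v (q.2, q.1)) f‖ ^ 2 := by
    refine (summable_prod_of_nonneg fun _ => by positivity).2 ⟨fun n => (hre n).summable, ?_⟩
    simp only [fun n => (hre n).tsum_eq]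
    exact (hasSum_re hA').summable
  have ht : HasSum (fun p : ℤ × ℤ => ‖inner ℂ (v p) f‖ ^ 2) (inner ℂ f (S f)).re := by
    have h1 := hs.hasSum
    have h2 := h1.prod_fiberwise hre
    rw [h2.unique (hasSum_re hA')] at h1
    exact (Equiv.prodComm ℤ ℤ).hasSum_iff.1 h1
  refine (sum_le_hasSum s (fun _ _ => by positivity) ht).trans ?_
  calc (inner ℂ f (S f)).re ≤ ‖inner ℂ f (S f)‖ := re_le_norm _
    _ ≤ ‖f‖ * ‖S f‖ := norm_inner_le_norm _ _
    _ ≤ ‖f‖ * (‖S‖ * ‖f‖) := mul_le_mul_of_nonneg_left (S.le_opNorm f) (norm_nonneg _)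
    _ = ‖S‖ * ‖f‖ ^ 2 := by ring

/-- The frame operator is determined by its weak iterated sums on a dense set. -/
theorem hasSum_frame_of_weak [CompleteSpace H] {v : ℤ × ℤ → H} {S : H →L[ℂ] H} {D : Set H}
    (hD : Dense D)
    (h : ∀ φ ∈ D, ∀ f ∈ D, ∃ A : ℤ → ℂ,
      (∀ n, HasSum (fun m => inner ℂ (v (m, n)) f * inner ℂ φ (v (m, n))) (A n)) ∧
        HasSum A (inner ℂ φ (S f))) (f : H) :
    HasSum (fun p => inner ℂ (v p) f • v p) (S f) := by
  have hs := summable_inner_smul_of_bessel (norm_nonneg S)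
    (bessel_of_weak hD fun f hf => h f hf f hf)
  have hw : ∀ φ f, HasSum (fun p => inner ℂ (v p) f * inner ℂ φ (v p))
      (inner ℂ φ (∑' p, inner ℂ (v p) f • v p)) := fun φ f => by
    have := (innerSL ℂ φ).hasSum (hs f).hasSum
    simpa only [Function.comp_def, innerSL_apply_apply, inner_smul_right] using this
  have hDD : ∀ φ ∈ D, ∀ f ∈ D, inner ℂ φ (∑' p, inner ℂ (v p) f • v p) = inner ℂ φ (S f) :=
    fun φ hφ f hf => by
      obtain ⟨A, hA, hA'⟩ := h φ hφ f hf
      exact (((Equiv.prodComm ℤ ℤ).hasSum_iff.2 (hw φ f)).prod_fiberwise hA).unique hA'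
  -- Symmetry of the frame operator lets it act on the test vector `φ ∈ D`, where it equals `S`;
  -- general `f` is then reached without a separate proof that the frame operator is continuous.
  have hsymm : ∀ φ f, inner ℂ φ (∑' p, inner ℂ (v p) f • v p) =
      inner ℂ (∑' p, inner ℂ (v p) φ • v p) f := fun φ f => by
    refine (hw φ f).unique ?_
    have := (hw f φ).star
    simp only [star_mul', Complex.star_def, inner_conj_symm] at this
    simpa only [mul_comm] using this
  have hfr : ∀ φ ∈ D, ∑' p, inner ℂ (v p) φ • v p = S φ := fun φ hφ =>
    hD.eq_of_inner_right ℂ fun u hu => hDD u hu φ hφ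
  have hSsymm : ∀ φ ∈ D, ∀ f, inner ℂ (S φ) f = inner ℂ φ (S f) := fun φ hφ =>
    congrFun (Continuous.ext_on hD (by fun_prop) (by fun_prop) fun f hf => by
      rw [← hDD φ hφ f hf, hsymm, hfr φ hφ])
  have : ∑' p, inner ℂ (v p) f • v p = S f :=
    hD.eq_of_inner_right ℂ fun φ hφ => by rw [hsymm, hfr φ hφ, hSsymm φ hφ]
  rw [← this]
  exact (hs f).hasSum

end Bessel

/-! ### Test functions in `L²` -/

open scoped ContDiff

theorem HasCompactSupport.memLp_two {f : ℝ → ℂ} (hf : HasCompactSupport f) (hc : Continuous f) :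
    MemLp f 2 volume := hc.memLp_of_hasCompactSupport hf

/-- The classes of smooth compactly supported functions are dense in `L²(ℝ)`. -/
theorem dense_toL2_contDiff :
    Dense {F : Lp ℂ 2 (volume : Measure ℝ) |
      ∃ f : ℝ → ℂ, ContDiff ℝ ∞ f ∧ HasCompactSupport f ∧ toL2 f = F} := by
  intro F
  refine Metric.mem_closure_iff.2 fun ε hε => ?_
  obtain ⟨g, hg₁, hg₂, hg₃⟩ := MemLp.exist_eLpNorm_sub_le (p := 2) (by simp) (by simp)
    (Lp.memLp F) (half_pos hε)
  refine ⟨toL2 g, ⟨g, hg₂, hg₁, rfl⟩, ?_⟩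
  have hae : (F : ℝ → ℂ) - (toL2 g : ℝ → ℂ) =ᵐ[volume] (F : ℝ → ℂ) - g := by
    filter_upwards [toL2_ae (hg₁.memLp_two hg₂.continuous)] with x hx
    simp [hx]
  rw [Lp.dist_def, eLpNorm_congr_ae hae]
  refine (ENNReal.toReal_mono ENNReal.ofReal_ne_top hg₃).trans_lt ?_
  rw [ENNReal.toReal_ofReal (by positivity)]
  linarith

theorem inner_toL2 {u v : ℝ → ℂ} (hu : MemLp u 2 volume) (hv : MemLp v 2 volume) :
    inner ℂ (toL2 u) (toL2 v) = ∫ x, star (u x) * v x := by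
  rw [L2.inner_def]
  refine integral_congr_ae ?_
  filter_upwards [toL2_ae hu, toL2_ae hv] with x h1 h2
  rw [h1, h2, RCLike.inner_apply, mul_comm]
  rfl

theorem HasCompactSupport.exists_abs_le_of_ne_zero {f : ℝ → ℂ} (hf : HasCompactSupport f) :
    ∃ R : ℝ, ∀ x, f x ≠ 0 → |x| ≤ R := by
  obtain ⟨R, hR⟩ := hf.isCompact.isBounded.exists_norm_le
  exact ⟨R, fun x hx => hR x (subset_tsupport f hx)⟩

/-- Only finitely many translates of a compactly supported function meet a bounded set. -/
theorem HasCompactSupport.exists_finset_translates {f : ℝ → ℂ} (hf : HasCompactSupport f) {β : ℝ}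
    (hβ : 0 < β) (R : ℝ) :
    ∃ J : Finset ℤ, ∀ x : ℝ, |x| ≤ R → ∀ j ∉ J, f (x - j / β) = 0 := by
  obtain ⟨R', hR'⟩ := hf.exists_abs_le_of_ne_zero
  refine ⟨Finset.Icc (-⌈(R + R') * β⌉) ⌈(R + R') * β⌉, fun x hx j hj => ?_⟩
  by_contra hne
  have h1 := hR' _ hne
  have h2 : |(j : ℝ)| ≤ (R + R') * β := by
    have : |(j : ℝ) / β| ≤ R + R' := by
      have := abs_sub_le ((j : ℝ) / β) x 0
      rw [sub_zero, sub_zero, abs_sub_comm] at this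
      linarith
    rwa [abs_div, abs_of_pos hβ, div_le_iff₀ hβ] at this
  have h3 := h2.trans (Int.le_ceil _)
  rw [abs_le] at h3
  refine hj (Finset.mem_Icc.2 ⟨?_, ?_⟩)
  · exact_mod_cast h3.1
  · exact_mod_cast h3.2

/-! ### Walnut's representation on test functions -/

section Weak

variable {g : ℝ → ℂ} {α β : ℝ}

theorem norm_apply_mul_norm_apply_le {K : ℝ} {R : ℝ}
    (hK : ∀ x : ℝ, |x| ≤ R → ∀ n : ℤ, ‖g (x - α * n)‖ ^ 2 ≤ K * (1 + (n : ℝ) ^ 2)⁻¹)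
    {x y : ℝ} (hx : |x| ≤ R) (hy : |y| ≤ R) (n : ℤ) :
    ‖g (x - α * n)‖ * ‖g (y - α * n)‖ ≤ K * (1 + (n : ℝ) ^ 2)⁻¹ := by
  nlinarith [hK x hx n, hK y hy n, sq_nonneg (‖g (x - α * n)‖ - ‖g (y - α * n)‖)]

/-- The sum over modulations, by Poisson summation. -/
theorem hasSum_inner_gaborAtom (hβ : 0 < β) (hg : ContDiff ℝ ∞ g) (hg2 : MemLp g 2 volume)
    {f φ : ℝ → ℂ} (hf : ContDiff ℝ ∞ f) (hfs : HasCompactSupport f) (hφ : Continuous φ)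
    (hφs : HasCompactSupport φ) (n : ℤ) :
    HasSum (fun m : ℤ => inner ℂ (gaborAtom g α β (m, n)) (toL2 f) *
        inner ℂ (toL2 φ) (gaborAtom g α β (m, n)))
      (∫ x, star (φ x) * g (x - α * n) *
        ((β : ℂ)⁻¹ * ∑' j : ℤ, f (x - j / β) * star (g (x - j / β - α * n)))) := by
  have hFs : HasCompactSupport fun t => f t * star (g (t - α * n)) := hfs.mul_right
  have hFd : ContDiff ℝ ∞ fun t => f t * star (g (t - α * n)) :=
    hf.mul ((starL' ℝ (A := ℂ)).contDiff.comp (hg.comp (contDiff_id.sub contDiff_const)))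
  -- Both factors are smooth and `f` has compact support, so `F` is Schwartz. Its Fourier transform
  -- at `mβ` is the coefficient of `f` against the atom `(m, n)`.
  set F : 𝓢(ℝ, ℂ) := hFs.toSchwartzMap hFd with hF
  have hFx : ∀ t, F t = f t * star (g (t - α * n)) := fun t => rfl
  set C : ℤ → ℂ := fun m => ∫ t, F t * cexp (-(2 * π * I * (m * β : ℝ) * t)) with hC
  have hterm : ∀ m : ℤ, inner ℂ (gaborAtom g α β (m, n)) (toL2 f) *
      inner ℂ (toL2 φ) (gaborAtom g α β (m, n)) =
      ∫ x, star (φ x) * g (x - α * n) * (cexp (2 * π * I * (m * β : ℝ) * x) * C m) := fun m => by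
    have hm := memLp_tfShift hg2 (α * n) (β * m)
    rw [gaborAtom, inner_toL2 hm (hfs.memLp_two hf.continuous),
      inner_toL2 (hφs.memLp_two hφ) hm]
    have h1 : ∫ x, star (tfShift (α * n) (β * m) g x) * f x = C m := by
      refine integral_congr_ae (.of_forall fun x => ?_)
      simp only [hFx, tfShift, Complex.star_def, map_mul, ← Complex.exp_conj, conj_ofReal, conj_I,
        map_ofNat]
      have : cexp (2 * π * -I * (β * m : ℝ) * x) = cexp (-(2 * π * I * (m * β : ℝ) * x)) := by
        congr 1
        push_cast
        ring
      rw [this]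
      ring
    rw [h1, mul_comm, ← integral_mul_const]
    refine integral_congr_ae (.of_forall fun x => ?_)
    simp only [tfShift, mul_comm β]
    ring
  have hPois := hasSum_charDist_reflectAt hβ F
  -- At `x = 0` the characters are 1, and summability of the Poisson series is that of the
  -- coefficients.
  have hCs : Summable C := by simpa [hC] using (hPois 0).summable
  have hK : Integrable fun x => star (φ x) * g (x - α * n) := by
    refine Continuous.integrable_of_hasCompactSupport ?_ ?_
    · exact hφ.star.mul (hg.continuous.comp (by fun_prop))
    · exact HasCompactSupport.mul_right (hφs.comp_left (g := star) (star_zero _))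
  -- The characters have modulus 1, so the integrals of the norms are `‖C m‖` times a fixed
  -- integral.
  have hsum := hasSum_integral_of_summable_integral_norm (μ := volume)
    (F := fun (m : ℤ) (x : ℝ) =>
      star (φ x) * g (x - α * n) * (cexp (2 * π * I * (m * β : ℝ) * x) * C m))
    (fun m => by
      refine (hK.mul_bdd (c := ‖C m‖) ?_ (.of_forall fun x => ?_))
      · exact Continuous.aestronglyMeasurable (by fun_prop)
      · rw [norm_mul, norm_char, one_mul])
    (by
      simp only [norm_mul _ (_ * C _), norm_mul _ (C _), norm_char, one_mul, integral_mul_const]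
      exact hCs.norm.mul_left _)
  simp only [hterm]
  convert hsum using 1
  · rfl
  refine integral_congr_ae (.of_forall fun x => ?_)
  simp only [tsum_mul_left]
  rw [(hPois x).tsum_eq]
  simp only [hFx]

/-- The sum over translations, by dominated convergence. -/
theorem hasSum_integral_translates {G : ℝ → ℝ → ℂ} (hβ : 0 < β) (hg : Continuous g)
    (hK : ∀ R : ℝ, ∃ K, ∀ x : ℝ, |x| ≤ R → ∀ n : ℤ,
      ‖g (x - α * n)‖ ^ 2 ≤ K * (1 + (n : ℝ) ^ 2)⁻¹)
    (hG : ∀ x s, HasSum (fun n : ℤ => g (x - α * n) * star (g (x - s - α * n))) (G x s))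
    {f φ : ℝ → ℂ} (hf : Continuous f) (hfs : HasCompactSupport f) (hφ : Continuous φ)
    (hφs : HasCompactSupport φ) :
    HasSum (fun n : ℤ => ∫ x, star (φ x) * g (x - α * n) *
        ((β : ℂ)⁻¹ * ∑' j : ℤ, f (x - j / β) * star (g (x - j / β - α * n))))
      (∫ x, star (φ x) * ((β : ℂ)⁻¹ * ∑' j : ℤ, f (x - j / β) * G x (j / β))) := by
  obtain ⟨R₁, hR₁⟩ := hφs.exists_abs_le_of_ne_zero
  obtain ⟨R₂, hR₂⟩ := hfs.exists_abs_le_of_ne_zero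
  -- A single finite set of `j` works for all `x` in the support of `φ`; the decay constant is taken
  -- on a ball containing both supports, since `x` and `x - j/β` both enter.
  obtain ⟨J, hJ⟩ := hfs.exists_finset_translates hβ R₁
  obtain ⟨K, hK⟩ := hK (max R₁ R₂)
  obtain ⟨M, hM⟩ := hfs.exists_bound_of_continuous hf
  have hfin : ∀ (c : ℤ → ℂ) (x : ℝ), star (φ x) * ∑' j : ℤ, f (x - j / β) * c j =
      star (φ x) * ∑ j ∈ J, f (x - j / β) * c j := fun c x => by
    by_cases h : φ x = 0
    · simp [h]
    · rw [tsum_eq_sum fun j hj => by rw [hJ x (hR₁ x h) j hj, zero_mul]]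
  have e₁ : ∀ (n : ℤ) (x : ℝ), star (φ x) * g (x - α * n) *
        ((β : ℂ)⁻¹ * ∑' j : ℤ, f (x - j / β) * star (g (x - j / β - α * n))) =
      star (φ x) * ((β : ℂ)⁻¹ *
        ∑ j ∈ J, f (x - j / β) * (g (x - α * n) * star (g (x - j / β - α * n)))) := fun n x => by
    have := hfin (fun j => star (g (x - j / β - α * n))) x
    calc _ = g (x - α * n) * (β : ℂ)⁻¹ *
          (star (φ x) * ∑' j : ℤ, f (x - j / β) * star (g (x - j / β - α * n))) := by ring
      _ = _ := by
        rw [this, Finset.mul_sum, Finset.mul_sum, Finset.mul_sum, Finset.mul_sum]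
        exact Finset.sum_congr rfl fun j _ => by ring
  have e₂ : ∀ x : ℝ, star (φ x) * ((β : ℂ)⁻¹ * ∑' j : ℤ, f (x - j / β) * G x (j / β)) =
      star (φ x) * ((β : ℂ)⁻¹ * ∑ j ∈ J, f (x - j / β) * G x (j / β)) := fun x => by
    rw [mul_left_comm, hfin (fun j => G x (j / β)) x, mul_left_comm]
  simp only [e₁, e₂]
  have hM0 : 0 ≤ M := (norm_nonneg _).trans (hM 0)
  have hbs : Summable fun n : ℤ => β⁻¹ * (J.card * (M * (K * (1 + (n : ℝ) ^ 2)⁻¹))) :=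
    (((summable_inv_one_add_int_sq.mul_left K).mul_left M).mul_left _).mul_left _
  refine hasSum_integral_of_dominated_convergence
    (fun n x => ‖φ x‖ * (β⁻¹ * (J.card * (M * (K * (1 + (n : ℝ) ^ 2)⁻¹)))))
    (fun n => ?_) (fun n => .of_forall fun x => ?_) (.of_forall fun x => hbs.mul_left _) ?_
    (.of_forall fun x => ?_)
  · have : Continuous fun x : ℝ => ∑ j ∈ J,
        f (x - j / β) * (g (x - α * n) * star (g (x - j / β - α * n))) := by fun_prop
    exact (hφ.star.mul (continuous_const.mul this)).aestronglyMeasurable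
  · by_cases h : φ x = 0
    · simp [h]
    rw [norm_mul, norm_star, norm_mul, norm_inv, norm_real, Real.norm_of_nonneg hβ.le]
    refine mul_le_mul_of_nonneg_left (mul_le_mul_of_nonneg_left ?_ (by positivity)) (norm_nonneg _)
    rw [← nsmul_eq_mul]
    refine (norm_sum_le _ _).trans (Finset.sum_le_card_nsmul _ _ _ fun j _ => ?_)
    have hx : |x| ≤ max R₁ R₂ := (hR₁ x h).trans (le_max_left _ _)
    have hK0 : 0 ≤ K * (1 + (n : ℝ) ^ 2)⁻¹ := (by positivity : (0 : ℝ) ≤ _).trans (hK x hx n)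
    by_cases h' : f (x - j / β) = 0
    · rw [h', zero_mul, norm_zero]
      positivity
    rw [norm_mul, norm_mul, norm_star]
    exact mul_le_mul (hM _) (norm_apply_mul_norm_apply_le hK hx
      ((hR₂ _ h').trans (le_max_right _ _)) n) (by positivity) hM0
  · simp only [tsum_mul_left]
    exact (hφ.integrable_of_hasCompactSupport hφs).norm.mul_const _
  · have : HasSum (fun n : ℤ => ∑ j ∈ J,
        f (x - j / β) * (g (x - α * n) * star (g (x - j / β - α * n))))
        (∑ j ∈ J, f (x - j / β) * G x (j / β)) :=
      hasSum_sum fun j _ => (hG x (j / β)).mul_left _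
    exact (this.mul_left _).mul_left _

/-- The frame operator of a smooth window with the decay of the Cauchy kernel is any bounded
operator given on smooth compactly supported functions by Walnut's formula. -/
theorem hasSum_frameTerm {G : ℝ → ℝ → ℂ} (hβ : 0 < β) (hg : ContDiff ℝ ∞ g)
    (hg2 : MemLp g 2 volume)
    (hK : ∀ R : ℝ, ∃ K, ∀ x : ℝ, |x| ≤ R → ∀ n : ℤ,
      ‖g (x - α * n)‖ ^ 2 ≤ K * (1 + (n : ℝ) ^ 2)⁻¹)
    (hG : ∀ x s, HasSum (fun n : ℤ => g (x - α * n) * star (g (x - s - α * n))) (G x s))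
    {S : Lp ℂ 2 (volume : Measure ℝ) →L[ℂ] Lp ℂ 2 (volume : Measure ℝ)}
    (hS : ∀ f : ℝ → ℂ, ContDiff ℝ ∞ f → HasCompactSupport f → S (toL2 f) =ᵐ[volume]
      fun x => (β : ℂ)⁻¹ * ∑' j : ℤ, f (x - j / β) * G x (j / β))
    (f : Lp ℂ 2 (volume : Measure ℝ)) : HasSum (frameTerm g α β f) (S f) := by
  refine hasSum_frame_of_weak dense_toL2_contDiff ?_ f
  rintro _ ⟨φ, hφ, hφs, rfl⟩ _ ⟨f, hf, hfs, rfl⟩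
  refine ⟨_, fun n => hasSum_inner_gaborAtom hβ hg hg2 hf hfs hφ.continuous hφs n, ?_⟩
  convert hasSum_integral_translates hβ hg.continuous hK hG hf.continuous hfs hφ.continuous hφs
    using 1
  rw [L2.inner_def]
  refine integral_congr_ae ?_
  filter_upwards [toL2_ae (hφs.memLp_two hφ.continuous), hS f hf hfs] with x h1 h2
  rw [h1, h2, RCLike.inner_apply, mul_comm]
  rfl

end Weak

/-! ### The window and the multipliers: smoothness and bounds -/

theorem contDiff_trigCauchyWindow {N : ℕ} (a : Fin N → ℂ) (b : Fin N → ℝ) {w : ℝ} (hw : w ≠ 0) :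
    ContDiff ℝ ∞ (trigCauchyWindow a b w) := by
  have h1 : ContDiff ℝ ∞ fun t : ℝ => (t : ℂ) := ofRealCLM.contDiff
  change ContDiff ℝ ∞ fun t : ℝ => _ / _
  simp only [div_eq_mul_inv]
  refine (ContDiff.sum fun k _ => ?_).mul ((h1.sub contDiff_const).inv (sub_mul_I_ne_zero hw))
  exact contDiff_const.mul (contDiff_const.mul h1).cexp

theorem norm_trigCauchyWindow_sq_le {N : ℕ} (a : Fin N → ℂ) (b : Fin N → ℝ) (w t : ℝ) :
    ‖trigCauchyWindow a b w t‖ ^ 2 ≤ (∑ k, ‖a k‖) ^ 2 * (t ^ 2 + w ^ 2)⁻¹ := by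
  have hn : ‖(t - I * w : ℂ)‖ ^ 2 = t ^ 2 + w ^ 2 := by
    rw [← normSq_eq_norm_sq, normSq_apply]
    simp
    ring
  rw [trigCauchyWindow, norm_div, div_pow, hn, div_eq_mul_inv]
  refine mul_le_mul_of_nonneg_right (pow_le_pow_left₀ (norm_nonneg _) ?_ 2) (by positivity)
  exact (norm_sum_le _ _).trans
    (Finset.sum_le_sum fun k _ => by rw [norm_mul, norm_char, mul_one])

theorem exists_norm_trigCauchyWindow_translate_le {α w : ℝ} (hα : α ≠ 0) (hw : w ≠ 0) {N : ℕ}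
    (a : Fin N → ℂ) (b : Fin N → ℝ) (R : ℝ) :
    ∃ K, ∀ x : ℝ, |x| ≤ R → ∀ n : ℤ,
      ‖trigCauchyWindow a b w (x - α * n)‖ ^ 2 ≤ K * (1 + (n : ℝ) ^ 2)⁻¹ := by
  obtain ⟨K, -, hK⟩ := exists_inv_sq_add_sq_le hα hw R
  refine ⟨(∑ k, ‖a k‖) ^ 2 * K, fun x hx n => (norm_trigCauchyWindow_sq_le a b w _).trans ?_⟩
  rw [mul_assoc]
  exact mul_le_mul_of_nonneg_left (hK x hx n) (by positivity)

theorem exp_add_I_mul_div_ne_one {α c : ℝ} (hα : α ≠ 0) (hc : c ≠ 0) (t : ℝ) :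
    cexp (2 * π * I * ((t + I * c) / α)) ≠ 1 :=
  exp_two_pi_mul_I_mul_ne_one (im_add_I_mul_div_ne_zero hα hc t)

theorem exp_neg_add_I_mul_div_ne_one {α c : ℝ} (hα : α ≠ 0) (hc : c ≠ 0) (t : ℝ) :
    cexp (-(2 * π * I * ((t + I * c) / α))) ≠ 1 := by
  rw [Complex.exp_neg, Ne, inv_eq_one]
  exact exp_add_I_mul_div_ne_one hα hc t

theorem contDiff_inv_exp_sub_one {α c : ℝ} (hα : α ≠ 0) (hc : c ≠ 0) :
    ContDiff ℝ ∞ fun t : ℝ => 1 / (cexp (2 * π * I * ((t + I * c) / α)) - 1) := by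
  have h1 : ContDiff ℝ ∞ fun t : ℝ => (t : ℂ) := ofRealCLM.contDiff
  simp only [one_div]
  exact ((contDiff_const.mul ((h1.add contDiff_const).div_const _)).cexp.sub
    contDiff_const).inv fun t => sub_ne_zero.2 (exp_add_I_mul_div_ne_one hα hc t)

theorem contDiff_inv_one_sub_exp {α c : ℝ} (hα : α ≠ 0) (hc : c ≠ 0) :
    ContDiff ℝ ∞ fun t : ℝ => 1 / (1 - cexp (-(2 * π * I * ((t + I * c) / α)))) := by
  have h1 : ContDiff ℝ ∞ fun t : ℝ => (t : ℂ) := ofRealCLM.contDiff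
  simp only [one_div]
  exact (contDiff_const.sub
    (contDiff_const.mul ((h1.add contDiff_const).div_const _)).neg.cexp).inv
    fun t => sub_ne_zero.2 (exp_neg_add_I_mul_div_ne_one hα hc t).symm

theorem exists_norm_inv_exp_sub_one_le {α c : ℝ} (hα : α ≠ 0) (hc : c ≠ 0) :
    ∃ C, ∀ t : ℝ, ‖1 / (cexp (2 * π * I * ((t + I * c) / α)) - 1)‖ ≤ C := by
  have hr : 0 < |Real.exp (-(2 * π * c / α)) - 1| := by
    rw [abs_pos, sub_ne_zero]
    simp [hα, hc, Real.pi_ne_zero]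
  refine ⟨|Real.exp (-(2 * π * c / α)) - 1|⁻¹, fun t => ?_⟩
  rw [norm_div, norm_one, one_div]
  refine inv_anti₀ hr ?_
  simpa [norm_exp_shift] using abs_norm_sub_norm_le (cexp (2 * π * I * ((t + I * c) / α))) 1

theorem exists_norm_inv_one_sub_exp_le {α c : ℝ} (hα : α ≠ 0) (hc : c ≠ 0) :
    ∃ C, ∀ t : ℝ, ‖1 / (1 - cexp (-(2 * π * I * ((t + I * c) / α))))‖ ≤ C := by
  obtain ⟨C, hC⟩ := exists_norm_inv_exp_sub_one_le hα hc
  refine ⟨1 + C, fun t => ?_⟩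
  have h := sub_ne_zero.2 (exp_add_I_mul_div_ne_one hα hc t)
  rw [← exp_div_exp_sub_one]
  -- The two multipliers differ by the constant 1, so the bound on one gives the other.
  have e : cexp (2 * π * I * ((t + I * c) / α)) / (cexp (2 * π * I * ((t + I * c) / α)) - 1) =
      1 + 1 / (cexp (2 * π * I * ((t + I * c) / α)) - 1) := by
    rw [div_eq_iff h, add_mul, one_div_mul_cancel h, one_mul, sub_add_cancel]
  rw [e]
  exact (norm_add_le _ _).trans (by simpa using hC t)

/-- A bounded smooth function. -/
structure BoundedSmooth (u : ℝ → ℂ) : Prop where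
  contDiff : ContDiff ℝ ∞ u
  bounded : ∃ C, ∀ x, ‖u x‖ ≤ C

/-- Multiplication by a bounded smooth function on `L²(ℝ)`. -/
noncomputable def BoundedSmooth.mul {u : ℝ → ℂ} (hu : BoundedSmooth u) :
    Lp ℂ 2 (volume : Measure ℝ) →L[ℂ] Lp ℂ 2 (volume : Measure ℝ) :=
  mulL2 u hu.contDiff.continuous hu.bounded.choose hu.bounded.choose_spec

theorem BoundedSmooth.mul_ae {u : ℝ → ℂ} (hu : BoundedSmooth u)
    (f : Lp ℂ 2 (volume : Measure ℝ)) : hu.mul f =ᵐ[volume] fun x => f x * u x :=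
  mulL2_ae _ _ f

theorem BoundedSmooth.toL2_mul {u : ℝ → ℂ} (hu : BoundedSmooth u)
    (f : Lp ℂ 2 (volume : Measure ℝ)) : toL2 (fun x => f x * u x) = hu.mul f :=
  toL2_mul_eq _ _ f

theorem BoundedSmooth.char_neg (c : ℝ) : BoundedSmooth fun t => cexp (-(2 * π * I * c * t)) :=
  ⟨(contDiff_const.mul ofRealCLM.contDiff).neg.cexp, 1, fun t => (norm_char_neg c t).le⟩

theorem BoundedSmooth.char (c : ℝ) : BoundedSmooth fun t => cexp (2 * π * I * c * t) :=
  ⟨(contDiff_const.mul ofRealCLM.contDiff).cexp, 1, fun t => (norm_char c t).le⟩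

theorem BoundedSmooth.inv_exp_sub_one {α c : ℝ} (hα : α ≠ 0) (hc : c ≠ 0) :
    BoundedSmooth fun t : ℝ => 1 / (cexp (2 * π * I * ((t + I * c) / α)) - 1) :=
  ⟨contDiff_inv_exp_sub_one hα hc, exists_norm_inv_exp_sub_one_le hα hc⟩

theorem BoundedSmooth.inv_one_sub_exp {α c : ℝ} (hα : α ≠ 0) (hc : c ≠ 0) :
    BoundedSmooth fun t : ℝ => 1 / (1 - cexp (-(2 * π * I * ((t + I * c) / α)))) :=
  ⟨contDiff_inv_one_sub_exp hα hc, exists_norm_inv_one_sub_exp_le hα hc⟩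

theorem BoundedSmooth.fun_mul {u v : ℝ → ℂ} (hu : BoundedSmooth u) (hv : BoundedSmooth v) :
    BoundedSmooth fun t => u t * v t := by
  obtain ⟨C, hC⟩ := hu.bounded
  obtain ⟨D, hD⟩ := hv.bounded
  refine ⟨hu.contDiff.mul hv.contDiff, C * D, fun t => ?_⟩
  rw [norm_mul]
  exact mul_le_mul (hC t) (hD t) (norm_nonneg _) ((norm_nonneg _).trans (hC t))

/-- The operator `f ↦ convL2 T f` of an `L²`-convolutor. -/
noncomputable def IsL2Convolutor.clm {T : 𝓢'(ℝ, ℂ)} (hT : IsL2Convolutor T) :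
    Lp ℂ 2 (volume : Measure ℝ) →L[ℂ] Lp ℂ 2 (volume : Measure ℝ) := hT.choose

theorem IsL2Convolutor.convL2_eq {T : 𝓢'(ℝ, ℂ)} (hT : IsL2Convolutor T)
    (f : Lp ℂ 2 (volume : Measure ℝ)) : convL2 T f = hT.clm f :=
  hT.choose_spec.convL2_eq f

/-- The operator `f ↦ r · ((f q) * T)`. -/
noncomputable def IsL2Convolutor.sandwich {T : 𝓢'(ℝ, ℂ)} (hT : IsL2Convolutor T) {q r : ℝ → ℂ}
    (hq : BoundedSmooth q) (hr : BoundedSmooth r) :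
    Lp ℂ 2 (volume : Measure ℝ) →L[ℂ] Lp ℂ 2 (volume : Measure ℝ) :=
  hr.mul.comp (hT.clm.comp hq.mul)

theorem IsL2Convolutor.sandwich_ae {T : 𝓢'(ℝ, ℂ)} (hT : IsL2Convolutor T) {q r : ℝ → ℂ}
    (hq : BoundedSmooth q) (hr : BoundedSmooth r) (f : Lp ℂ 2 (volume : Measure ℝ)) :
    hT.sandwich hq hr f =ᵐ[volume] fun x => r x * convL2 T (toL2 fun t => f t * q t) x := by
  filter_upwards [hr.mul_ae (hT.clm (hq.mul f))] with x hx
  rw [hT.convL2_eq, hq.toL2_mul, mul_comm, ← hx]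
  rfl

/-- Smoothness of `q` keeps `f q` a test function, so the abstract extension to `L²` can be
evaluated by the distribution itself. -/
theorem IsL2Convolutor.sandwich_toL2_ae {T : 𝓢'(ℝ, ℂ)} (hT : IsL2Convolutor T) {q r : ℝ → ℂ}
    (hq : BoundedSmooth q) (hr : BoundedSmooth r) {f : ℝ → ℂ} (hf : ContDiff ℝ ∞ f)
    (hfs : HasCompactSupport f) :
    hT.sandwich hq hr (toL2 f) =ᵐ[volume]
      fun x => r x * schwartzConv T ((hfs.mul_right (f' := q)).toSchwartzMap
        (hf.mul hq.contDiff)) x := by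
  set ψ : 𝓢(ℝ, ℂ) := (hfs.mul_right (f' := q)).toSchwartzMap (hf.mul hq.contDiff) with hψ
  have h1 : hq.mul (toL2 f) = ψ.toLp 2 volume := by
    refine Lp.ext ?_
    filter_upwards [hq.mul_ae (toL2 f), toL2_ae (hfs.memLp_two hf.continuous),
      ψ.coeFn_toLp 2 volume] with x h1 h2 h3
    rw [h1, h2, h3]
    rfl
  filter_upwards [hr.mul_ae (hT.clm (ψ.toLp 2 volume)), hT.choose_spec ψ] with x h2 h3
  rw [sandwich, ContinuousLinearMap.comp_apply, ContinuousLinearMap.comp_apply, h1, h2, mul_comm]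
  exact congrArg (r x * ·) h3

theorem toL2_coe (f : Lp ℂ 2 (volume : Measure ℝ)) : toL2 (f : ℝ → ℂ) = f :=
  Lp.ext (toL2_ae (Lp.memLp f))

theorem BoundedSmooth.one : BoundedSmooth fun _ => 1 :=
  ⟨contDiff_const, 1, fun _ => by simp⟩

theorem BoundedSmooth.inv_exp_sub_one' {α c : ℝ} (hα : α ≠ 0) (hc : c ≠ 0) :
    BoundedSmooth fun t : ℝ => 1 / (cexp (2 * π * I * ((t - I * c) / α)) - 1) := by
  simpa [sub_eq_add_neg] using BoundedSmooth.inv_exp_sub_one hα (neg_ne_zero.2 hc)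

theorem BoundedSmooth.inv_one_sub_exp' {α c : ℝ} (hα : α ≠ 0) (hc : c ≠ 0) :
    BoundedSmooth fun t : ℝ => 1 / (1 - cexp (-(2 * π * I * ((t - I * c) / α)))) := by
  simpa [sub_eq_add_neg] using BoundedSmooth.inv_one_sub_exp hα (neg_ne_zero.2 hc)

/-! ### Almost everywhere representatives of linear combinations -/

section Lp

variable {u v : Lp ℂ 2 (volume : Measure ℝ)} {F G : ℝ → ℂ}

theorem Lp.add_ae (hu : u =ᵐ[volume] F) (hv : v =ᵐ[volume] G) :
    (u + v : Lp ℂ 2 (volume : Measure ℝ)) =ᵐ[volume] fun x => F x + G x := by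
  filter_upwards [hu, hv, Lp.coeFn_add u v] with x h1 h2 h3
  rw [h3, Pi.add_apply, h1, h2]

theorem Lp.sub_ae (hu : u =ᵐ[volume] F) (hv : v =ᵐ[volume] G) :
    (u - v : Lp ℂ 2 (volume : Measure ℝ)) =ᵐ[volume] fun x => F x - G x := by
  filter_upwards [hu, hv, Lp.coeFn_sub u v] with x h1 h2 h3
  rw [h3, Pi.sub_apply, h1, h2]

theorem Lp.smul_ae (c : ℂ) (hu : u =ᵐ[volume] F) :
    (c • u : Lp ℂ 2 (volume : Measure ℝ)) =ᵐ[volume] fun x => c * F x := by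
  filter_upwards [hu, Lp.coeFn_smul c u] with x h1 h2
  rw [h2, Pi.smul_apply, h1, smul_eq_mul]

theorem Lp.sum_ae {ι : Type*} (s : Finset ι) {u : ι → Lp ℂ 2 (volume : Measure ℝ)}
    {F : ι → ℝ → ℂ} (hu : ∀ i ∈ s, u i =ᵐ[volume] F i) :
    (∑ i ∈ s, u i : Lp ℂ 2 (volume : Measure ℝ)) =ᵐ[volume] fun x => ∑ i ∈ s, F i x := by
  classical
  induction s using Finset.induction_on with
  | empty => exact Lp.coeFn_zero ℂ 2 volume
  | insert i s hi ih =>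
    simp only [Finset.sum_insert hi]
    exact Lp.add_ae (hu i (Finset.mem_insert_self i s))
      (ih fun j hj => hu j (Finset.mem_insert_of_mem hj))

end Lp

/-! ### The explicit operator and the formula -/

section Main

variable {α β w : ℝ} {N : ℕ}

theorem isL2Convolutor_h1Sup1 (hβ : 0 < β) (hw : w ≠ 0) (a : Fin N → ℂ) (b : Fin N → ℝ) :
    IsL2Convolutor (h1Sup1 a b w β) :=
  (isL2Convolutor_hDist hβ hw).smulLeftCLM_trig (fun k l => star (a k) * a l) _ (fun _ l => b l)
    (fun k l => b l < b k)

theorem isL2Convolutor_h2Sup1 (hβ : 0 < β) (hw : w ≠ 0) (a : Fin N → ℂ) (b : Fin N → ℝ) :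
    IsL2Convolutor (h2Sup1 a b w β) :=
  (isL2Convolutor_hDist hβ hw).smulLeftCLM_trig (fun k l => star (a k) * a l) _ (fun k _ => b k)
    (fun k l => b l < b k)

theorem isL2Convolutor_h1Sup2 (hβ : 0 < β) (hw : w ≠ 0) (a : Fin N → ℂ) (b : Fin N → ℝ) :
    IsL2Convolutor (h1Sup2 a b w β) :=
  (isL2Convolutor_hDist hβ hw).smulLeftCLM_trig (fun k l => star (a k) * a l) _ (fun _ l => b l)
    (fun k l => b k < b l)

theorem isL2Convolutor_h2Sup2 (hβ : 0 < β) (hw : w ≠ 0) (a : Fin N → ℂ) (b : Fin N → ℝ) :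
    IsL2Convolutor (h2Sup2 a b w β) :=
  (isL2Convolutor_hDist hβ hw).smulLeftCLM_trig (fun k l => star (a k) * a l) _ (fun k _ => b k)
    (fun k l => b k < b l)

/-- The operator on the right-hand side of the formula for `α / (2πi) S`. -/
noncomputable def gaborOperator (hα : 0 < α) (hβ : 0 < β) (hw : w ≠ 0) (a : Fin N → ℂ)
    (b : Fin N → ℝ) : Lp ℂ 2 (volume : Measure ℝ) →L[ℂ] Lp ℂ 2 (volume : Measure ℝ) :=
  (isL2Convolutor_h1Sup1 hβ hw a b).sandwich (.inv_exp_sub_one hα.ne' hw) .one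
  - (isL2Convolutor_h2Sup1 hβ hw a b).sandwich .one (.inv_exp_sub_one' hα.ne' hw)
  + (isL2Convolutor_h1Sup2 hβ hw a b).sandwich (.inv_one_sub_exp hα.ne' hw) .one
  - (isL2Convolutor_h2Sup2 hβ hw a b).sandwich .one (.inv_one_sub_exp' hα.ne' hw)
  + ∑ k, ∑ l with b k = b l, (star (a k) * a l) •
    ((isL2Convolutor_hDist hβ hw).sandwich
        ((BoundedSmooth.char_neg (b k)).fun_mul (.inv_exp_sub_one hα.ne' hw)) (.char (b k))
      - (isL2Convolutor_hDist hβ hw).sandwich (.char_neg (b k))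
        ((BoundedSmooth.char (b k)).fun_mul (.inv_exp_sub_one' hα.ne' hw)))

theorem gaborOperator_ae (hα : 0 < α) (hβ : 0 < β) (hw : w ≠ 0) (a : Fin N → ℂ)
    (b : Fin N → ℝ) (f : Lp ℂ 2 (volume : Measure ℝ)) :
    ∀ᵐ x : ℝ, gaborOperator hα hβ hw a b f x =
      convL2 (h1Sup1 a b w β)
        (toL2 fun t => f t / (cexp (2 * π * I * ((t + I * w) / α)) - 1)) x
      - 1 / (cexp (2 * π * I * ((x - I * w) / α)) - 1) * convL2 (h2Sup1 a b w β) f x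
      + convL2 (h1Sup2 a b w β)
        (toL2 fun t => f t / (1 - cexp (-(2 * π * I * ((t + I * w) / α))))) x
      - 1 / (1 - cexp (-(2 * π * I * ((x - I * w) / α)))) * convL2 (h2Sup2 a b w β) f x
      + ∑ k, ∑ l with b k = b l, star (a k) * a l * cexp (2 * π * I * b k * x) *
        (convL2 (hDist β w)
          (toL2 fun t => f t * cexp (-(2 * π * I * b k * t)) /
            (cexp (2 * π * I * ((t + I * w) / α)) - 1)) x
        - 1 / (cexp (2 * π * I * ((x - I * w) / α)) - 1) *
          convL2 (hDist β w) (toL2 fun t => f t * cexp (-(2 * π * I * b k * t))) x) := by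
  have h := Lp.add_ae (Lp.sub_ae (Lp.add_ae (Lp.sub_ae
    ((isL2Convolutor_h1Sup1 hβ hw a b).sandwich_ae (.inv_exp_sub_one hα.ne' hw) .one f)
    ((isL2Convolutor_h2Sup1 hβ hw a b).sandwich_ae .one (.inv_exp_sub_one' hα.ne' hw) f))
    ((isL2Convolutor_h1Sup2 hβ hw a b).sandwich_ae (.inv_one_sub_exp hα.ne' hw) .one f))
    ((isL2Convolutor_h2Sup2 hβ hw a b).sandwich_ae .one (.inv_one_sub_exp' hα.ne' hw) f))
    (Lp.sum_ae Finset.univ fun k _ => Lp.sum_ae (Finset.univ.filter fun l => b k = b l) fun l _ =>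
      Lp.smul_ae (star (a k) * a l) (Lp.sub_ae
        ((isL2Convolutor_hDist hβ hw).sandwich_ae
          ((BoundedSmooth.char_neg (b k)).fun_mul (.inv_exp_sub_one hα.ne' hw)) (.char (b k)) f)
        ((isL2Convolutor_hDist hβ hw).sandwich_ae (.char_neg (b k))
          ((BoundedSmooth.char (b k)).fun_mul (.inv_exp_sub_one' hα.ne' hw)) f)))
  simp only [gaborOperator, _root_.add_apply, _root_.sub_apply, _root_.sum_apply,
    _root_.smul_apply]
  filter_upwards [h] with x hx
  refine hx.trans ?_
  simp only [mul_one, one_mul, mul_one_div, mul_div_assoc, toL2_coe]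
  congr 1
  refine Finset.sum_congr rfl fun k _ => Finset.sum_congr rfl fun l _ => ?_
  ring

theorem schwartzConv_smulLeftCLM_hDist_eq_sum (hβ : 0 < β) (hw : w ≠ 0) {u : ℝ → ℂ}
    (hu : u.HasTemperateGrowth) {ψ : 𝓢(ℝ, ℂ)} {f q : ℝ → ℂ} (hψ : ∀ x, ψ x = f x * q x)
    {x : ℝ} {J : Finset ℤ} (hJ : ∀ j ∉ J, f (x - j / β) = 0) :
    schwartzConv (TemperedDistribution.smulLeftCLM ℂ u (hDist β w)) ψ x =
      (β : ℂ)⁻¹ * ∑ j ∈ J, f (x - j / β) * (1 / ((j / β : ℝ) - 2 * I * w : ℂ) *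
        (u (j / β) * q (x - j / β))) := by
  rw [schwartzConv_smulLeftCLM_hDist hβ hw hu, tsum_eq_sum fun j hj => by simp [hψ, hJ j hj]]
  congr 1
  refine Finset.sum_congr rfl fun j _ => ?_
  rw [hψ]
  ring

theorem schwartzConv_hDist_eq_sum (hβ : 0 < β) (hw : w ≠ 0) {ψ : 𝓢(ℝ, ℂ)} {f q : ℝ → ℂ}
    (hψ : ∀ x, ψ x = f x * q x) {x : ℝ} {J : Finset ℤ} (hJ : ∀ j ∉ J, f (x - j / β) = 0) :
    schwartzConv (hDist β w) ψ x =
      (β : ℂ)⁻¹ * ∑ j ∈ J, f (x - j / β) * (1 / ((j / β : ℝ) - 2 * I * w : ℂ) *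
        q (x - j / β)) := by
  rw [schwartzConv_hDist hβ hw, tsum_eq_sum fun j hj => by simp [hψ, hJ j hj]]
  congr 1
  refine Finset.sum_congr rfl fun j _ => ?_
  rw [hψ]
  ring

/-- On smooth compactly supported functions the operator is given by the kernel. -/
theorem gaborOperator_toL2_ae (hα : 0 < α) (hβ : 0 < β) (hw : w ≠ 0) (a : Fin N → ℂ)
    (b : Fin N → ℝ) {f : ℝ → ℂ} (hf : ContDiff ℝ ∞ f) (hfs : HasCompactSupport f) :
    gaborOperator hα hβ hw a b (toL2 f) =ᵐ[volume]
      fun x => (β : ℂ)⁻¹ * ∑' j : ℤ, f (x - j / β) * gaborKernel α a b w x (j / β) := by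
  have h := Lp.add_ae (Lp.sub_ae (Lp.add_ae (Lp.sub_ae
    ((isL2Convolutor_h1Sup1 hβ hw a b).sandwich_toL2_ae (.inv_exp_sub_one hα.ne' hw) .one hf hfs)
    ((isL2Convolutor_h2Sup1 hβ hw a b).sandwich_toL2_ae .one (.inv_exp_sub_one' hα.ne' hw) hf hfs))
    ((isL2Convolutor_h1Sup2 hβ hw a b).sandwich_toL2_ae (.inv_one_sub_exp hα.ne' hw) .one hf hfs))
    ((isL2Convolutor_h2Sup2 hβ hw a b).sandwich_toL2_ae .one (.inv_one_sub_exp' hα.ne' hw) hf hfs))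
    (Lp.sum_ae Finset.univ fun k _ => Lp.sum_ae (Finset.univ.filter fun l => b k = b l) fun l _ =>
      Lp.smul_ae (star (a k) * a l) (Lp.sub_ae
        ((isL2Convolutor_hDist hβ hw).sandwich_toL2_ae
          ((BoundedSmooth.char_neg (b k)).fun_mul (.inv_exp_sub_one hα.ne' hw)) (.char (b k)) hf hfs)
        ((isL2Convolutor_hDist hβ hw).sandwich_toL2_ae (.char_neg (b k))
          ((BoundedSmooth.char (b k)).fun_mul (.inv_exp_sub_one' hα.ne' hw)) hf hfs)))
  simp only [gaborOperator, _root_.add_apply, _root_.sub_apply, _root_.sum_apply,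
    _root_.smul_apply]
  filter_upwards [h] with x hx
  -- For fixed `x` all series in `j` are finite sums over the same `J`, and the identity reduces to
  -- one for each `j`.
  obtain ⟨J, hJ⟩ := hfs.exists_finset_translates hβ |x|
  replace hJ := hJ x le_rfl
  rw [hx, tsum_eq_sum fun j hj => by rw [hJ j hj, zero_mul]]
  simp only [h1Sup1, h2Sup1, h1Sup2, h2Sup2]
  rw [schwartzConv_smulLeftCLM_hDist_eq_sum hβ hw (hasTemperateGrowth_trigGtFst a b w)
      (fun _ => rfl) hJ,
    schwartzConv_smulLeftCLM_hDist_eq_sum hβ hw (hasTemperateGrowth_trigGtSnd a b w)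
      (fun _ => rfl) hJ,
    schwartzConv_smulLeftCLM_hDist_eq_sum hβ hw (hasTemperateGrowth_trigLtFst a b w)
      (fun _ => rfl) hJ,
    schwartzConv_smulLeftCLM_hDist_eq_sum hβ hw (hasTemperateGrowth_trigLtSnd a b w)
      (fun _ => rfl) hJ]
  have e₁ := fun k => schwartzConv_hDist_eq_sum hβ hw
    (ψ := (hfs.mul_right (f' := _)).toSchwartzMap (hf.mul ((BoundedSmooth.char_neg (b k)).fun_mul
      (.inv_exp_sub_one hα.ne' hw)).contDiff)) (fun _ => rfl) hJ
  have e₂ := fun k => schwartzConv_hDist_eq_sum hβ hw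
    (ψ := (hfs.mul_right (f' := _)).toSchwartzMap (hf.mul (BoundedSmooth.char_neg (b k)).contDiff))
    (fun _ => rfl) hJ
  simp only [e₁, e₂]
  have hswap : ∀ (c : ℂ) (d : Fin N → Fin N → ℂ) (e : Fin N → Fin N → ℤ → ℂ),
      ∑ k, ∑ l with b k = b l, d k l * (c * ∑ j ∈ J, e k l j) =
        c * ∑ j ∈ J, ∑ k, ∑ l with b k = b l, d k l * e k l j := fun c d e => by
    rw [Finset.sum_comm, Finset.mul_sum]
    refine Finset.sum_congr rfl fun k _ => ?_
    rw [Finset.sum_comm, Finset.mul_sum]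
    refine Finset.sum_congr rfl fun l _ => ?_
    rw [← Finset.mul_sum]
    ring
  have hd : ∀ k l, star (a k) * a l * (cexp (2 * π * I * b k * x) * ((β : ℂ)⁻¹ * ∑ j ∈ J,
        f (x - j / β) * (1 / ((j / β : ℝ) - 2 * I * w : ℂ) *
          (cexp (-(2 * π * I * b k * (x - j / β : ℝ))) *
            (1 / (cexp (2 * π * I * (((x - j / β : ℝ) + I * w) / α)) - 1))))) -
      cexp (2 * π * I * b k * x) * (1 / (cexp (2 * π * I * ((x - I * w) / α)) - 1)) *
        ((β : ℂ)⁻¹ * ∑ j ∈ J, f (x - j / β) * (1 / ((j / β : ℝ) - 2 * I * w : ℂ) *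
          cexp (-(2 * π * I * b k * (x - j / β : ℝ)))))) =
      star (a k) * a l * cexp (2 * π * I * b k * x) * ((β : ℂ)⁻¹ * ∑ j ∈ J,
        f (x - j / β) * (1 / ((j / β : ℝ) - 2 * I * w : ℂ)) *
          (cexp (-(2 * π * I * b k * (x - j / β : ℝ))) /
            (cexp (2 * π * I * (((x - j / β : ℝ) + I * w) / α)) - 1) -
          1 / (cexp (2 * π * I * ((x - I * w) / α)) - 1) *
            cexp (-(2 * π * I * b k * (x - j / β : ℝ))))) := fun k l => by
    simp only [mul_sub, Finset.sum_sub_distrib]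
    simp only [Finset.mul_sum]
    congr 1 <;> refine Finset.sum_congr rfl fun j _ => ?_ <;> ring
  simp only [hd, hswap]
  simp only [Finset.mul_sum, ← Finset.sum_sub_distrib, ← Finset.sum_add_distrib]
  refine Finset.sum_congr rfl fun j _ => ?_
  simp only [gaborKernel, mul_add, mul_sub, Finset.mul_sum]
  congr 1
  · ring
  · refine Finset.sum_congr rfl fun k _ => Finset.sum_congr rfl fun l _ => ?_
    ring

end Main

/-- The explicit operator and the frame operator have the same Walnut kernel up to the factor
`2πi/α`. -/
theorem hasSum_frameTerm_trigCauchyWindow {α β w : ℝ} (hα : 0 < α) (hβ : 0 < β) (hw : w ≠ 0)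
    {N : ℕ} (a : Fin N → ℂ) (b : Fin N → ℝ) (hαb : ∀ k l, α * |b k - b l| ≤ 1)
    (f : Lp ℂ 2 (volume : Measure ℝ)) :
    HasSum (frameTerm (trigCauchyWindow a b w) α β f)
      ((2 * π * I / α : ℂ) • gaborOperator hα hβ hw a b f) := by
  refine hasSum_frameTerm (S := (2 * π * I / α : ℂ) • gaborOperator hα hβ hw a b) hβ
    (contDiff_trigCauchyWindow a b hw) (memLp_trigCauchyWindow a b hw)
    (exists_norm_trigCauchyWindow_translate_le hα.ne' hw a b)
    (hasSum_trigCauchyWindow_mul_star hα hw a b hαb) (fun f hf hfs => ?_) f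
  filter_upwards [Lp.smul_ae (2 * π * I / α : ℂ) (gaborOperator_toL2_ae hα hβ hw a b hf hfs)]
    with x hx
  refine hx.trans ?_
  rw [mul_left_comm, ← tsum_mul_left]
  congr 1
  exact tsum_congr fun j => by ring

theorem mainTheorem4 (α β w : ℝ) (hα : 0 < α) (hβ : 0 < β) (hw : w ≠ 0)
    (N : ℕ) (a : Fin N → ℂ) (b : Fin N → ℝ) (hαb : ∀ k l, α * |b k - b l| ≤ 1) :
    -- the series defining `h` converges, and all the convolutions are bounded operators on `L²(ℝ)`
    Summable (fun m : ℤ => charDist (m * β)) ∧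
    IsL2Convolutor (hDist β w) ∧
    IsL2Convolutor (h1Sup1 a b w β) ∧ IsL2Convolutor (h2Sup1 a b w β) ∧
    IsL2Convolutor (h1Sup2 a b w β) ∧ IsL2Convolutor (h2Sup2 a b w β) ∧
    ∀ f : Lp ℂ 2 (volume : Measure ℝ),
      Summable (frameTerm (trigCauchyWindow a b w) α β f) ∧
      ∀ᵐ x : ℝ,
        (α / (2 * π * I) : ℂ) * frameOperator (trigCauchyWindow a b w) α β f x =
          convL2 (h1Sup1 a b w β)
            (toL2 fun t => f t / (cexp (2 * π * I * ((t + I * w) / α)) - 1)) x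
          - 1 / (cexp (2 * π * I * ((x - I * w) / α)) - 1) * convL2 (h2Sup1 a b w β) f x
          + convL2 (h1Sup2 a b w β)
            (toL2 fun t => f t / (1 - cexp (-(2 * π * I * ((t + I * w) / α))))) x
          - 1 / (1 - cexp (-(2 * π * I * ((x - I * w) / α)))) * convL2 (h2Sup2 a b w β) f x
          + ∑ k, ∑ l with b k = b l, star (a k) * a l * cexp (2 * π * I * b k * x) *
            (convL2 (hDist β w)
              (toL2 fun t => f t * cexp (-(2 * π * I * b k * t)) /
                (cexp (2 * π * I * ((t + I * w) / α)) - 1)) x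
            - 1 / (cexp (2 * π * I * ((x - I * w) / α)) - 1) *
              convL2 (hDist β w) (toL2 fun t => f t * cexp (-(2 * π * I * b k * t))) x) := by
  refine ⟨(hasSum_charDist hβ).summable, isL2Convolutor_hDist hβ hw,
    isL2Convolutor_h1Sup1 hβ hw a b, isL2Convolutor_h2Sup1 hβ hw a b,
    isL2Convolutor_h1Sup2 hβ hw a b, isL2Convolutor_h2Sup2 hβ hw a b, fun f => ?_⟩
  have h := hasSum_frameTerm_trigCauchyWindow hα hβ hw a b hαb f
  refine ⟨h.summable, ?_⟩
  have hα' : (α : ℂ) ≠ 0 := by exact_mod_cast hα.ne'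
  have hpi : (π : ℂ) ≠ 0 := by exact_mod_cast Real.pi_ne_zero
  have e : (α / (2 * π * I) : ℂ) • frameOperator (trigCauchyWindow a b w) α β f =
      gaborOperator hα hβ hw a b f := by
    rw [frameOperator, h.tsum_eq, smul_smul, div_mul_div_comm, mul_comm (α : ℂ), div_self, one_smul]
    exact mul_ne_zero (mul_ne_zero (mul_ne_zero two_ne_zero hpi) I_ne_zero) hα'
  filter_upwards [gaborOperator_ae hα hβ hw a b f,
    Lp.coeFn_smul (α / (2 * π * I) : ℂ) (frameOperator (trigCauchyWindow a b w) α β f)]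
    with x h1 h2
  rw [← h1, ← e, h2, Pi.smul_apply, smul_eq_mul]
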